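/- There is a deterministic fully dynamic algorithm with the following guarantee. Its input is an integer $k\ge 1$ and a finite set $P$ of points of an arbitrary metric space $(\mathcal X,\operatorname{dist})$, which is then changed by an arbitrary (adversarial) sequence of updates, each inserting a point of $\mathcal X$ that is not in $P$ or deleting a point of $P$. The algorithm is a single computable procedure for all metric spaces and all $k$; it processes each update before the next one arrives, and it accesses the metric only through finitely many comparisons of integer multiples of distances between points that have been inserted so far. For the current point set $P$ let $$R^*=\min_{S'\subseteq P,\ |S'|\le k}\ \max_{p\in P}\ \operatorname{dist}(p,S'),\qquad \operatorname{dist}(p,S')=\min_{q\in S'}\operatorname{dist}(p,q),$$ be the optimal $k$-center radius. The algorithm maintains an ordered set $S\subseteq P$ of centers such that, initially and after every update: 1. $S$ is a distance-$50R^*$ dominating set in $P$, i.e. $\operatorname{dist}(p,S)\le 50R^*$ for every $p\in P$; moreover $|S|=k$ whenever $|P|\ge k$, and $S=P$ whenever $|P|<k$. 2. $S$ changes by at most one point per update: if $S_{\mathrm{old}}$ and $S$ are the sets of centers before and after an update, then $|S\setminus S_{\mathrm{old}}|\le 1$ and $|S_{\mathrm{old}}\setminus S|\le 1$ (so when both have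 size $k$, the recourse, which is half the size of their symmetric difference, is at most $1$). Changes of the order of the centers are not counted. -/

import Mathlib

/-! ### The k-center problem -/

namespace KCenter

/-- The cost (radius) `max_{p ∈ P} dist(p, S)` of a set of centers `S` for the point set `P`, with
`dist(p, S) = min_{q ∈ S} dist(p, q)`. It is `⊤` if `S` is empty and `P` is not. -/
noncomputable def cost {X : Type*} [MetricSpace X] (P S : Finset X) : ENNReal :=
  ⨆ p ∈ P, Metric.infEDist p (S : Set X)

/-- The optimal radius `R* = min_{S ⊆ P, |S| ≤ k} max_{p ∈ P} dist(p, S)`. -/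
noncomputable def optRadius {X : Type*} [MetricSpace X] (P : Finset X) (k : ℕ) : ENNReal :=
  ⨅ (S : Finset X) (_ : S ⊆ P ∧ S.card ≤ k), cost P S

/-- `S` is a distance-`r` dominating set in `P`: a subset of `P` such that every point of `P` is
within distance `r` of `S`. -/
def IsDominatingSet {X : Type*} [MetricSpace X] (P S : Finset X) (r : ENNReal) : Prop :=
  S ⊆ P ∧ ∀ p ∈ P, Metric.infEDist p (S : Set X) ≤ r

/-! ### Point updates

The points are named `0, 1, 2, …` in the order of their arrival, and `x : ℕ → X` gives their
positions in the metric space. The first `n₀` points form the initial point set. A point that is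
inserted again after a deletion arrives under a new name. -/

/-- `insert`: the next point arrives; `delete i`: the point with name `i` is deleted. -/
inductive Update where
  | insert : Update
  | delete (i : ℕ) : Update

/-- The number of points that have arrived so far, and the names of those currently present. -/
structure Population where
  arrived : ℕ
  live : Finset ℕ

def Population.initial (n₀ : ℕ) : Population := ⟨n₀, Finset.range n₀⟩

def Population.apply (w : Population) : Update → Population
  | .insert => ⟨w.arrived + 1, Insert.insert w.arrived w.live⟩
  | .delete i => ⟨w.arrived, w.live.erase i⟩

/-- The population after the first `t` updates of the sequence `u`. -/
def population (n₀ : ℕ) (u : ℕ → Update) : ℕ → Population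
  | 0 => Population.initial n₀
  | t + 1 => (population n₀ u t).apply (u t)

open Classical in
/-- The points with the given names, as a set of points of the metric space. -/
noncomputable def pointsOf {X : Type*} (x : ℕ → X) (I : Finset ℕ) : Finset X := I.image x

/-- The current point set `P`. -/
noncomputable def Population.points {X : Type*} (x : ℕ → X) (w : Population) : Finset X :=
  pointsOf x w.live

/-- Only points outside `P` are inserted, and only points of `P` are deleted. -/
def Update.Legal {X : Type*} (x : ℕ → X) (w : Population) : Update → Prop
  | .insert => x w.arrived ∉ w.points x
  | .delete i => i ∈ w.live

/-- The initial points are distinct and the first `T` updates are legal. -/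
def LegalInput {X : Type*} (x : ℕ → X) (n₀ : ℕ) (u : ℕ → Update) (T : ℕ) : Prop :=
  (∀ i < n₀, ∀ j < n₀, x i = x j → i = j) ∧
    ∀ t < T, (u t).Legal x (population n₀ u t)

/-! ### Deterministic dynamic algorithms -/

/-- An elementary question about the metric: is `m * dist(a, b) ≤ n * dist(c, d)`? -/
structure Comparison where
  m : ℕ
  a : ℕ
  b : ℕ
  n : ℕ
  c : ℕ
  d : ℕ

/-- What an algorithm receives: an update of the point set, or the answer to its last question. -/
inductive Message where
  | update (u : Update) : Message
  | answer (b : Bool) : Message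

/-- What an algorithm does: it asks a question, or it finishes the current update by announcing its
ordered set of centers (a list of names). -/
inductive Action where
  | ask (q : Comparison) : Action
  | output (S : List ℕ) : Action

def Update.equiv : Update ≃ Option ℕ where
  toFun | .insert => none | .delete i => some i
  invFun | none => .insert | some i => .delete i
  left_inv u := by cases u <;> rfl
  right_inv u := by cases u <;> rfl

def Comparison.equiv : Comparison ≃ (ℕ × ℕ × ℕ) × (ℕ × ℕ × ℕ) where
  toFun q := ((q.m, q.a, q.b), (q.n, q.c, q.d))
  invFun p := ⟨p.1.1, p.1.2.1, p.1.2.2, p.2.1, p.2.2.1, p.2.2.2⟩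
  left_inv _ := rfl
  right_inv _ := rfl

instance : Primcodable Update := Primcodable.ofEquiv _ Update.equiv

instance : Primcodable Comparison := Primcodable.ofEquiv _ Comparison.equiv

def Message.equiv : Message ≃ Update ⊕ Bool where
  toFun | .update u => .inl u | .answer b => .inr b
  invFun | .inl u => .update u | .inr b => .answer b
  left_inv v := by cases v <;> rfl
  right_inv v := by cases v <;> rfl

def Action.equiv : Action ≃ Comparison ⊕ List ℕ where
  toFun | .ask q => .inl q | .output S => .inr S
  invFun | .inl q => .ask q | .inr S => .output S
  left_inv v := by cases v <;> rfl
  right_inv v := by cases v <;> rfl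

instance : Primcodable Message := Primcodable.ofEquiv _ Message.equiv

instance : Primcodable Action := Primcodable.ofEquiv _ Action.equiv

/-- A deterministic dynamic algorithm: a computable rule that determines the next action from the
number of centers `k`, the initial number of points `n₀`, and all messages received so far (the
latest one first). The metric is accessible only through comparisons of distances. -/
structure DynamicAlgorithm where
  next : ℕ → ℕ → List Message → Action
  computable : Computable fun z : ℕ × ℕ × List Message => next z.1 z.2.1 z.2.2

open Classical in
/-- The truthful answer to a question when `N` points have arrived; questions about points that have
not yet arrived are answered `false`. -/
noncomputable def Comparison.eval {X : Type*} [MetricSpace X] (x : ℕ → X) (N : ℕ)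
    (q : Comparison) : Bool :=
  decide ((q.a < N ∧ q.b < N ∧ q.c < N ∧ q.d < N) ∧
    (q.m : ℝ) * dist (x q.a) (x q.b) ≤ (q.n : ℝ) * dist (x q.c) (x q.d))

/-- `Responds x N k n₀ A h h' S`: started with the messages `h` when `N` points have arrived, the
algorithm asks finitely many questions and then announces `S`; the messages received up to then
are `h'`. At most one pair `(h', S)` has this property. -/
inductive Responds {X : Type*} [MetricSpace X] (x : ℕ → X) (N k n₀ : ℕ) (A : DynamicAlgorithm) :
    List Message → List Message → List ℕ → Prop where
  | output {h : List Message} {S : List ℕ} (hS : A.next k n₀ h = .output S) :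
      Responds x N k n₀ A h h S
  | ask {h h' : List Message} {S : List ℕ} {q : Comparison} (hq : A.next k n₀ h = .ask q)
      (hr : Responds x N k n₀ A (.answer (q.eval x N) :: h) h' S) :
      Responds x N k n₀ A h h' S

/-- The run of the algorithm on the initial points and the first `T` updates: `h t` are the messages
received and `S t` is the list of centers announced after `t` updates. -/
structure IsRun {X : Type*} [MetricSpace X] (A : DynamicAlgorithm) (k : ℕ) (x : ℕ → X) (n₀ : ℕ)
    (u : ℕ → Update) (T : ℕ) (h : ℕ → List Message) (S : ℕ → List ℕ) : Prop where
  start : Responds x n₀ k n₀ A [] (h 0) (S 0)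
  step : ∀ t < T, Responds x (population n₀ u (t + 1)).arrived k n₀ A
    (.update (u t) :: h t) (h (t + 1)) (S (t + 1))

/-- The set of centers named by a list. -/
noncomputable def centers {X : Type*} (x : ℕ → X) (S : List ℕ) : Finset X :=
  pointsOf x S.toFinset

end KCenter

/-! A set of `k` centers is good whenever it has a `Certificate` at some scale `s`, with no relation
between `s` and the optimum `R` assumed. The certificate has two halves. If `s ≤ 2 * R`, the
representatives suffice: a point is within `10 * s` of an origin, whose representative is a center
within `15 * s` of it, or is the origin itself with a center within `5 * s / 4`; so every point has
a center within `25 * s ≤ 50 * R`. If `s > 2 * R`, the `k` anchors lie in distinct optimal clusters,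
hence meet every cluster, and the centers next to them serve all points
(`Certificate.exists_dist_le`).

To maintain a certificate, note that an update leaves at most one ball unserved: that of a new
point, or that of a lost representative. Alternating paths of shifts move this hole around
(`Reps.augment`). Either the balls can be rearranged so that the hole disappears, or a point `u` far
from all representatives and centers can serve it. In the second case `u` becomes a center. If some
center is not needed by any representative, it is exchanged for `u`. Otherwise the representatives
and `u` are `k + 1` points more than `5 * s` apart, and the scale is raised to their minimal
distance (`exists_certified_of_card_succ`). When a deletion hits a center or an anchor, a nearby
anchor-center pair is discarded and one new center is found (`Anchors.exists_certified_insert`);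
when the anchors and the rearranged balls offer none, the farthest point from the remaining centers
fixes a new scale.

Thus a certified set one swap away always exists. Computability is then soft: a certificate is a
finite object verified by finitely many comparisons, so the algorithm asks all comparisons and tries
all candidates until one passes a primitive recursive check. -/

/-! ### Primitive recursive predicates with quantifiers over lists -/

theorem PrimrecPred.forall_mem {α β : Type*} [Primcodable α] [Primcodable β] {f : α → List β}
    {p : α → β → Prop} (hf : Primrec f) (hp : PrimrecPred fun z : α × β => p z.1 z.2) :
    PrimrecPred fun a => ∀ b ∈ f a, p a b :=
  (PrimrecRel.forall_mem_list (R := fun b a => p a b)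
    (hp.comp (Primrec.snd.pair Primrec.fst))).comp hf Primrec.id

theorem PrimrecPred.exists_mem {α β : Type*} [Primcodable α] [Primcodable β] {f : α → List β}
    {p : α → β → Prop} (hf : Primrec f) (hp : PrimrecPred fun z : α × β => p z.1 z.2) :
    PrimrecPred fun a => ∃ b ∈ f a, p a b :=
  (PrimrecRel.exists_mem_list (R := fun b a => p a b)
    (hp.comp (Primrec.snd.pair Primrec.fst))).comp hf Primrec.id

theorem PrimrecPred.mem {α β : Type*} [Primcodable α] [Primcodable β] {f : α → β}
    {g : α → List β} (hf : Primrec f) (hg : Primrec g) : PrimrecPred fun a => f a ∈ g a :=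
  (PrimrecPred.exists_mem (p := fun a b => b = f a) hg
    (Primrec.eq.comp Primrec.snd (hf.comp Primrec.fst))).of_eq fun a => by simp

theorem PrimrecPred.nodup {α : Type*} [Primcodable α] {f : α → List ℕ} (hf : Primrec f) :
    PrimrecPred fun a => (f a).Nodup := by
  refine (PrimrecPred.forall_mem (f := fun a => List.range (f a).length)
    (p := fun a i => ∀ j ∈ List.range i, ¬ (f a)[j]? = (f a)[i]?)
    (Primrec.list_range.comp (Primrec.list_length.comp hf)) ?_).of_eq fun a => ?_
  · refine PrimrecPred.forall_mem (f := fun z : α × ℕ => List.range z.2)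
      (p := fun z j => ¬ (f z.1)[j]? = (f z.1)[z.2]?) (Primrec.list_range.comp Primrec.snd) ?_
    exact (Primrec.eq.comp
      (Primrec.list_getElem?.comp (hf.comp (Primrec.fst.comp Primrec.fst)) Primrec.snd)
      (Primrec.list_getElem?.comp (hf.comp (Primrec.fst.comp Primrec.fst))
        (Primrec.snd.comp Primrec.fst))).not
  · simp only [List.mem_range, List.nodup_iff_getElem?_ne_getElem?]
    exact ⟨fun h i j hij hj => h j hj i hij, fun h i hi j hj => h j i hj hi⟩

namespace KCenter

/-! ### Certified sets of centers -/

/-! ### Representatives and alternating shifts -/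

section Reps

variable {X : Type*} [MetricSpace X]

/-- Representatives `v ∈ V` at scale `5 * s`, each in charge of the ball of radius `10 * s` around
its origin `o v`, which may be a deleted point. A representative is a center or has a center
nearby; in the latter case it is its own origin. -/
structure Reps (x : ℕ → X) (N : ℕ) (L S : Finset ℕ) (s : ℝ) (V : Finset ℕ) (o : ℕ → ℕ) :
    Prop where
  subset : V ⊆ L
  lt : ∀ v ∈ V, o v < N
  sep : ∀ v ∈ V, ∀ w ∈ V, v ≠ w → 5 * s < dist (x v) (x w)
  rep : ∀ v ∈ V, dist (x v) (x (o v)) ≤ 15 * s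
  real : ∀ v ∈ V, v ∈ S ∨ (o v = v ∧ ∃ f ∈ S, 4 * dist (x v) (x f) ≤ 5 * s)

/-- The balls of the representatives cover the point set. -/
def Covers (x : ℕ → X) (L : Finset ℕ) (s : ℝ) (V : Finset ℕ) (o : ℕ → ℕ) : Prop :=
  ∀ p ∈ L, ∃ v ∈ V, dist (x p) (x (o v)) ≤ 10 * s

/-- The balls of the representatives and the ball around `b` cover the point set. -/
def CoversWith (x : ℕ → X) (L : Finset ℕ) (s : ℝ) (V : Finset ℕ) (o : ℕ → ℕ) (b : ℕ) : Prop :=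
  ∀ p ∈ L, (∃ v ∈ V, dist (x p) (x (o v)) ≤ 10 * s) ∨ dist (x p) (x b) ≤ 10 * s

/-- A representative `v` takes over the ball around the unserved origin `b`, and its former origin
becomes unserved. -/
def Shift (x : ℕ → X) (L S : Finset ℕ) (s : ℝ) (V : Finset ℕ) (c c' : (ℕ → ℕ) × ℕ) : Prop :=
  ∃ v ∈ V, v ∈ S ∧ (∃ p ∈ L, dist (x p) (x c.2) ≤ 10 * s ∧ dist (x p) (x v) ≤ 5 * s) ∧
    c' = (Function.update c.1 v c.2, c.1 v)

variable {x : ℕ → X} {N k : ℕ} {L S V W : Finset ℕ} {s : ℝ} {o : ℕ → ℕ} {b : ℕ}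

theorem Reps.shift {c c' : (ℕ → ℕ) × ℕ} (hV : Reps x N L S s V c.1) (hb : c.2 < N)
    (hc : CoversWith x L s V c.1 c.2) (h : Shift x L S s V c c') :
    Reps x N L S s V c'.1 ∧ c'.2 < N ∧ CoversWith x L s V c'.1 c'.2 := by
  obtain ⟨v, hv, hvS, ⟨p, hp, hpb, hpv⟩, rfl⟩ := h
  refine ⟨⟨hV.subset, ?_, hV.sep, ?_, ?_⟩, hV.lt v hv, ?_⟩
  · intro w hw
    by_cases h : w = v
    · subst h; simpa using hb
    · simpa [Function.update_of_ne h] using hV.lt w hw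
  · intro w hw
    by_cases h : w = v
    · subst h
      -- The witness `p` lies in the unserved ball and within `5 * s` of the representative; `10 +
      -- 5` is the constant `15` of `Reps.rep`.
      have := dist_triangle_left (x w) (x c.2) (x p)
      simp only [Function.update_self]
      linarith
    · simpa [Function.update_of_ne h] using hV.rep w hw
  · intro w hw
    by_cases h : w = v
    · subst h; exact .inl hvS
    · simpa [Function.update_of_ne h] using hV.real w hw
  · intro q hq
    rcases hc q hq with ⟨w, hw, hd⟩ | hd
    · by_cases h : w = v
      · subst h; exact .inr hd
      · exact .inl ⟨w, hw, by simpa [Function.update_of_ne h] using hd⟩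
    · exact .inl ⟨v, hv, by simpa using hd⟩

/-- The representatives are within reach of all points they are in charge of, and `u` is a further
point, far from all representatives and centers, that can serve the origin `b`. -/
structure Free (x : ℕ → X) (N : ℕ) (L S : Finset ℕ) (s : ℝ) (V : Finset ℕ) (o : ℕ → ℕ)
    (u b : ℕ) : Prop where
  mem : u ∈ L
  lt : b < N
  far : ∀ v ∈ V, 5 * s < dist (x u) (x v)
  alone : ∀ f ∈ S, 5 * s < 4 * dist (x u) (x f)
  rep : dist (x u) (x b) ≤ 10 * s
  covers : CoversWith x L s V o b

-- Explore all configurations reachable by shifts. If some reachable unserved ball contains a point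
-- more than `5 * s` from every representative, that point is free, and `hmax` keeps it away from
-- the centers. Otherwise every point of every reachable unserved ball is within `5 * s` of a
-- representative, and making the representatives so met their own origins closes the hole.
open Relation in
theorem Reps.augment_of_maximal (hs : 0 ≤ s) (hLN : ∀ i ∈ L, i < N)
    (hV : Reps x N L S s V o) (hb : b < N) (hc : CoversWith x L s V o b)
    (hmax : ∀ p ∈ L, (∀ v ∈ V, 5 * s < dist (x p) (x v)) →
      ∀ f ∈ S, 5 * s < 4 * dist (x p) (x f)) :
    (∃ V o, Reps x N L S s V o ∧ Covers x L s V o) ∨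
      ∃ V o u b, Reps x N L S s V o ∧ Free x N L S s V o u b := by
  classical
  let R : (ℕ → ℕ) × ℕ → Prop := ReflTransGen (Shift x L S s V) (o, b)
  have hR : ∀ c, R c → Reps x N L S s V c.1 ∧ c.2 < N ∧ CoversWith x L s V c.1 c.2 := by
    intro c h
    induction h with
    | refl => exact ⟨hV, hb, hc⟩
    | tail _ h ih => exact ih.1.shift ih.2.1 ih.2.2 h
  by_cases hfree : ∃ c, R c ∧ ∃ p ∈ L, dist (x p) (x c.2) ≤ 10 * s ∧
      ∀ v ∈ V, 5 * s < dist (x p) (x v)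
  · obtain ⟨c, h, p, hp, hpc, hpV⟩ := hfree
    obtain ⟨h1, h2, h3⟩ := hR c h
    exact .inr ⟨V, c.1, p, c.2, h1, hp, h2, hpV, hmax p hp hpV, hpc, h3⟩
  · left
    push Not at hfree
    -- The representatives met by the search.
    let A : ℕ → Prop := fun v => ∃ c, R c ∧ ∃ p ∈ L, dist (x p) (x c.2) ≤ 10 * s ∧
      dist (x p) (x v) ≤ 5 * s
    -- An origin that has changed along the path was itself unserved at some reachable moment.
    have hJ : ∀ c, R c → ∀ v, c.1 v = o v ∨ ∃ c', R c' ∧ c'.2 = o v := by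
      intro c h
      induction h with
      | refl => exact fun v => .inl rfl
      | @tail c c' h h' ih =>
        intro w
        have hc' : R c' := h.tail h'
        obtain ⟨v, hv, hvS, -, rfl⟩ := h'
        by_cases hw : w = v
        · subst hw
          exact (ih w).elim (fun e => .inr ⟨_, hc', e⟩) .inr
        · simpa [Function.update_of_ne hw] using ih w
    -- Resetting a met representative loses nothing: its old ball is centered at itself, or is a
    -- reachable unserved ball and hence covered by `hreach`.
    have hA : ∀ v ∈ V, A v → o v = v ∨ ∃ c, R c ∧ c.2 = o v := by
      rintro v hv ⟨c, h, p, hp, h1, h2⟩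
      rcases hV.real v hv with hvS | hvS
      · refine .inr ?_
        rcases hJ c h v with e | e
        · exact ⟨_, h.tail ⟨v, hv, hvS, ⟨p, hp, h1, h2⟩, rfl⟩, e⟩
        · exact e
      · exact .inl hvS.1
    have hreach : ∀ c, R c → ∀ p ∈ L, dist (x p) (x c.2) ≤ 10 * s →
        ∃ v ∈ V, A v ∧ dist (x p) (x v) ≤ 10 * s := by
      intro c h p hp hpc
      obtain ⟨v, hv, hpv⟩ := hfree c h p hp hpc
      exact ⟨v, hv, ⟨c, h, p, hp, hpc, hpv⟩, by linarith⟩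
    refine ⟨V, fun v => if A v then v else o v, ⟨hV.subset, ?_, hV.sep, ?_, ?_⟩, ?_⟩
    · intro v hv
      split_ifs
      exacts [hLN v (hV.subset hv), hV.lt v hv]
    · intro v hv
      split_ifs
      · rw [dist_self]; linarith
      · exact hV.rep v hv
    · intro v hv
      refine (hV.real v hv).imp_right fun h => ⟨?_, h.2⟩
      split_ifs
      exacts [rfl, h.1]
    · intro p hp
      suffices h : (∃ v ∈ V, A v ∧ dist (x p) (x v) ≤ 10 * s) ∨
          ∃ v ∈ V, ¬ A v ∧ dist (x p) (x (o v)) ≤ 10 * s by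
        rcases h with ⟨v, hv, h, hd⟩ | ⟨v, hv, h, hd⟩ <;> exact ⟨v, hv, by simpa [h] using hd⟩
      rcases hc p hp with ⟨v, hv, hd⟩ | hd
      · by_cases h : A v
        · left
          rcases hA v hv h with e | ⟨c, hcR, e⟩
          · exact ⟨v, hv, h, by rwa [e] at hd⟩
          · exact hreach c hcR p hp (by rwa [e])
        · exact .inr ⟨v, hv, h, hd⟩
      · exact .inl (hreach (o, b) .refl p hp hd)

/-- A point far from all representatives but near a center joins as a representative that is its own
origin, with that center as stand-in. This uses up points of `L \ V`, so it ends in the maximal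
case. -/
theorem Reps.augment (hs : 0 ≤ s) (hLN : ∀ i ∈ L, i < N)
    (hV : Reps x N L S s V o) (hb : b < N) (hc : CoversWith x L s V o b) :
    (∃ V o, Reps x N L S s V o ∧ Covers x L s V o) ∨
      ∃ V o u b, Reps x N L S s V o ∧ Free x N L S s V o u b := by
  classical
  induction hn : (L \ V).card using Nat.strong_induction_on generalizing V o with
  | _ n ih =>
    by_cases hmax : ∀ p ∈ L, (∀ v ∈ V, 5 * s < dist (x p) (x v)) →
      ∀ f ∈ S, 5 * s < 4 * dist (x p) (x f)
    · exact hV.augment_of_maximal hs hLN hb hc hmax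
    · push Not at hmax
      obtain ⟨p, hp, hpV, f, hf, hpf⟩ := hmax
      have hpV' : p ∉ V := fun h => by
        have := hpV p h
        rw [dist_self] at this
        linarith
      have hne : ∀ v ∈ V, v ≠ p := fun v hv e => hpV' (e ▸ hv)
      refine ih _ ?_ (V := insert p V) (o := Function.update o p p) ⟨?_, ?_, ?_, ?_, ?_⟩ ?_ rfl
      · rw [← hn]
        refine Finset.card_lt_card ⟨Finset.sdiff_subset_sdiff subset_rfl (Finset.subset_insert _ _),
          fun h => ?_⟩
        have := h (Finset.mem_sdiff.2 ⟨hp, hpV'⟩)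
        simp at this
      · exact Finset.insert_subset hp hV.subset
      · intro v hv
        rcases Finset.mem_insert.1 hv with rfl | hv
        · simpa using hLN v hp
        · simpa [Function.update_of_ne (hne v hv)] using hV.lt v hv
      · intro v hv w hw hvw
        rcases Finset.mem_insert.1 hv with rfl | hv' <;> rcases Finset.mem_insert.1 hw with rfl | hw'
        · exact absurd rfl hvw
        · exact hpV w hw'
        · rw [dist_comm]; exact hpV v hv'
        · exact hV.sep v hv' w hw' hvw
      · intro v hv
        rcases Finset.mem_insert.1 hv with rfl | hv
        · simpa using by linarith
        · simpa [Function.update_of_ne (hne v hv)] using hV.rep v hv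
      · intro v hv
        rcases Finset.mem_insert.1 hv with rfl | hv
        · exact .inr ⟨by simp, f, hf, hpf⟩
        · simpa [Function.update_of_ne (hne v hv)] using hV.real v hv
      · intro q hq
        refine (hc q hq).imp_left fun ⟨v, hv, hd⟩ => ⟨v, Finset.mem_insert_of_mem hv, ?_⟩
        simpa [Function.update_of_ne (hne v hv)] using hd

theorem Free.reps_insert {u : ℕ} (hs : 0 ≤ s) (hV : Reps x N L S s V o)
    (hu : Free x N L S s V o u b) {S' : Finset ℕ} (huS : u ∈ S')
    (hS : ∀ v ∈ V, v ∈ S' ∨ (o v = v ∧ ∃ f ∈ S', 4 * dist (x v) (x f) ≤ 5 * s)) :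
    Reps x N L S' s (insert u V) (Function.update o u b) ∧
      Covers x L s (insert u V) (Function.update o u b) := by
  have hne : ∀ v ∈ V, v ≠ u := by
    rintro v hv rfl
    have := hu.far v hv
    rw [dist_self] at this
    linarith
  refine ⟨⟨Finset.insert_subset hu.mem hV.subset, ?_, ?_, ?_, ?_⟩, ?_⟩
  · intro v hv
    rcases Finset.mem_insert.1 hv with rfl | hv
    · simpa using hu.lt
    · simpa [Function.update_of_ne (hne v hv)] using hV.lt v hv
  · intro v hv w hw hvw
    rcases Finset.mem_insert.1 hv with rfl | hv' <;> rcases Finset.mem_insert.1 hw with rfl | hw'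
    · exact absurd rfl hvw
    · exact hu.far w hw'
    · rw [dist_comm]; exact hu.far v hv'
    · exact hV.sep v hv' w hw' hvw
  · intro v hv
    rcases Finset.mem_insert.1 hv with rfl | hv
    · have := hu.rep
      simpa using by linarith
    · simpa [Function.update_of_ne (hne v hv)] using hV.rep v hv
  · intro v hv
    rcases Finset.mem_insert.1 hv with rfl | hv
    · exact .inl huS
    · simpa [Function.update_of_ne (hne v hv)] using hS v hv
  · intro q hq
    rcases hu.covers q hq with ⟨v, hv, hd⟩ | hd
    · refine ⟨v, Finset.mem_insert_of_mem hv, ?_⟩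
      simpa [Function.update_of_ne (hne v hv)] using hd
    · exact ⟨u, Finset.mem_insert_self _ _, by simpa using hd⟩

end Reps

/-! ### Certificates and changes of scale -/

section Certificate

variable {X : Type*} [MetricSpace X]

/-- Anchors at scale `s`: points at distance at least `s` from each other, each of them with a
center nearby. -/
structure Anchors (x : ℕ → X) (L S : Finset ℕ) (s : ℝ) (W : Finset ℕ) : Prop where
  subset : W ⊆ L
  sep : ∀ v ∈ W, ∀ w ∈ W, v ≠ w → s ≤ dist (x v) (x w)
  near : ∀ w ∈ W, ∃ f ∈ S, 4 * dist (x w) (x f) ≤ s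

/-- A certificate that `S` is a good set of `k` centers for the point set `L`. -/
structure Certificate (x : ℕ → X) (N : ℕ) (L S : Finset ℕ) (k : ℕ) (s : ℝ) (W V : Finset ℕ)
    (o : ℕ → ℕ) : Prop where
  scale : ∃ a < N, ∃ b < N, s = dist (x a) (x b)
  pos : 0 < s
  subset : S ⊆ L
  card : S.card = k
  anchors : Anchors x L S s W
  card_anchors : W.card = k
  reps : Reps x N L S s V o
  covers : Covers x L s V o

def Certified (x : ℕ → X) (N : ℕ) (L S : Finset ℕ) (k : ℕ) : Prop :=
  ∃ s W V o, Certificate x N L S k s W V o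

def OneSwap (S S' : Finset ℕ) : Prop := (S' \ S).card ≤ 1 ∧ (S \ S').card ≤ 1

theorem OneSwap.insert_erase (S : Finset ℕ) (f u : ℕ) : OneSwap S (insert u (S.erase f)) := by
  constructor
  · refine (Finset.card_le_card (t := {u}) fun i hi => ?_).trans (by simp)
    simp only [Finset.mem_sdiff, Finset.mem_insert, Finset.mem_erase, Finset.mem_singleton] at *
    tauto
  · refine (Finset.card_le_card (t := {f}) fun i hi => ?_).trans (by simp)
    simp only [Finset.mem_sdiff, Finset.mem_insert, Finset.mem_erase, Finset.mem_singleton] at *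
    tauto

theorem OneSwap.refl (S : Finset ℕ) : OneSwap S S := by simp [OneSwap]

variable {x : ℕ → X} {N k : ℕ} {L S V W T : Finset ℕ} {s : ℝ} {o : ℕ → ℕ} {b : ℕ}

theorem exists_closest_pair (hT : 1 < T.card) : ∃ i ∈ T, ∃ j ∈ T, i ≠ j ∧
    ∀ v ∈ T, ∀ w ∈ T, v ≠ w → dist (x i) (x j) ≤ dist (x v) (x w) := by
  obtain ⟨a, ha, b, hb, hab⟩ := Finset.one_lt_card.1 hT
  obtain ⟨⟨i, j⟩, hij, hmin⟩ := T.offDiag.exists_min_image (fun p => dist (x p.1) (x p.2))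
    ⟨(a, b), by simp [ha, hb, hab]⟩
  rw [Finset.mem_offDiag] at hij
  exact ⟨i, hij.1, j, hij.2.1, hij.2.2, fun v hv w hw h => hmin (v, w) (by simp [hv, hw, h])⟩

theorem exists_net {u : ℕ} (hu : u ∈ T) {r : ℝ} (hr : 0 ≤ r) : ∃ V ⊆ T, u ∈ V ∧
    (∀ v ∈ V, ∀ w ∈ V, v ≠ w → r < dist (x v) (x w)) ∧
    ∀ t ∈ T, ∃ v ∈ V, dist (x t) (x v) ≤ r := by
  classical
  obtain ⟨V, hV, hmax⟩ := (T.powerset.filter fun V => u ∈ V ∧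
    ∀ v ∈ V, ∀ w ∈ V, v ≠ w → r < dist (x v) (x w)).exists_max_image Finset.card
    ⟨{u}, by simp [hu]⟩
  simp only [Finset.mem_filter, Finset.mem_powerset] at hV hmax
  refine ⟨V, hV.1, hV.2.1, hV.2.2, fun t ht => ?_⟩
  by_contra! h
  have htV : t ∉ V := fun h' => by
    have := h t h'
    rw [dist_self] at this
    linarith
  have := hmax (insert t V) ⟨Finset.insert_subset ht hV.1, Finset.mem_insert_of_mem hV.2.1, by
    intro v hv w hw hvw
    rcases Finset.mem_insert.1 hv with rfl | hv' <;> rcases Finset.mem_insert.1 hw with rfl | hw'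
    · exact absurd rfl hvw
    · exact h w hw'
    · rw [dist_comm]; exact h v hv'
    · exact hV.2.2 v hv' w hw' hvw⟩
  rw [Finset.card_insert_of_notMem htV] at this
  omega

theorem Certificate.of_net (hLN : ∀ i ∈ L, i < N)
    (hscale : ∃ a < N, ∃ b < N, s = dist (x a) (x b)) (hs : 0 < s) (hSL : S ⊆ L)
    (hS : S.card = k) (hW : Anchors x L S s W) (hWk : W.card = k) (hVL : V ⊆ L)
    (hV : ∀ v ∈ V, ∀ w ∈ V, v ≠ w → 5 * s < dist (x v) (x w))
    (hVS : ∀ v ∈ V, ∃ f ∈ S, 4 * dist (x v) (x f) ≤ 5 * s)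
    (hc : ∀ p ∈ L, ∃ v ∈ V, dist (x p) (x v) ≤ 10 * s) :
    Certificate x N L S k s W V id :=
  ⟨hscale, hs, hSL, hS, hW, hWk,
    ⟨hVL, fun v hv => hLN v (hVL hv), hV, fun v _ => by simp; linarith,
      fun v hv => .inr ⟨rfl, hVS v hv⟩⟩, hc⟩

/-- Among `k + 1` points that cover the point set, the centers can be adapted to the minimal
distance of these points. -/
theorem exists_certified_of_card_succ (hLN : ∀ i ∈ L, i < N)
    (hinj : ∀ i ∈ L, ∀ j ∈ L, x i = x j → i = j) (hk : 1 ≤ k) (hTL : T ⊆ L)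
    (hT : T.card = k + 1) {u : ℕ} (hu : u ∈ T) (hS : S.card = k) (hSL : S ⊆ L) (huS : u ∉ S)
    {r : ℝ} (hsep : ∀ v ∈ T, ∀ w ∈ T, v ≠ w → r ≤ dist (x v) (x w))
    (hnear : ∀ v ∈ T, v ≠ u → ∃ f ∈ S, 4 * dist (x v) (x f) ≤ r)
    (hc : ∀ p ∈ L, ∃ t ∈ T, dist (x p) (x t) ≤ 5 * r) :
    ∃ S', OneSwap S S' ∧ Certified x N L S' k := by
  obtain ⟨i, hi, j, hj, hij, hmin⟩ := exists_closest_pair (x := x) (T := T) (by omega)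
  set d := dist (x i) (x j) with hd
  have hd0 : 0 < d := dist_pos.2 fun h => hij (hinj i (hTL hi) j (hTL hj) h)
  have hrd : r ≤ d := hsep i hi j hj hij
  obtain ⟨V, hVT, huV, hV, hVc⟩ := exists_net (x := x) hu (r := 5 * d) (by linarith)
  -- The closest pair is at distance `d < 5 * d`, so the net misses one of its points; that point
  -- can be given up as an anchor.
  obtain ⟨w, hwT, hwV⟩ : ∃ w ∈ T, w ∉ V := by
    by_contra! h
    have := hV i (h i hi) j (h j hj) hij
    linarith
  have hwu : w ≠ u := fun h => hwV (h ▸ huV)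
  obtain ⟨f, hf, hwf⟩ := hnear w hwT hwu
  have hfu : u ≠ f := fun h => huS (h ▸ hf)
  have hnear' : ∀ v ∈ T, v ≠ w → ∃ g ∈ insert u (S.erase f), 4 * dist (x v) (x g) ≤ d := by
    intro v hv hvw
    by_cases hvu : v = u
    · exact ⟨u, Finset.mem_insert_self _ _, by rw [hvu, dist_self]; linarith⟩
    · obtain ⟨g, hg, hvg⟩ := hnear v hv hvu
      refine ⟨g, Finset.mem_insert_of_mem (Finset.mem_erase.2 ⟨?_, hg⟩), by linarith⟩
      -- The center of `w` is not needed elsewhere: two points of `T` sharing a center would be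
      -- within `r / 2 < d`.
      rintro rfl
      have := dist_triangle_right (x v) (x w) (x g)
      have := hmin v hv w hwT hvw
      linarith
  refine ⟨_, .insert_erase S f u, d, T.erase w, V, id, .of_net hLN
    ⟨i, hLN i (hTL hi), j, hLN j (hTL hj), rfl⟩ hd0 ?_ ?_ ⟨?_, ?_, ?_⟩ ?_ (hVT.trans hTL) hV ?_ ?_⟩
  · exact Finset.insert_subset (hTL hu) ((Finset.erase_subset _ _).trans hSL)
  · rw [Finset.card_insert_of_notMem (by simp [huS]), Finset.card_erase_of_mem hf]
    omega
  · exact (Finset.erase_subset _ _).trans hTL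
  · exact fun v hv w hw => hmin v (Finset.mem_of_mem_erase hv) w (Finset.mem_of_mem_erase hw)
  · exact fun v hv => hnear' v (Finset.mem_of_mem_erase hv) (Finset.ne_of_mem_erase hv)
  · rw [Finset.card_erase_of_mem hwT]
    omega
  · intro v hv
    obtain ⟨g, hg, h⟩ := hnear' v (hVT hv) fun e => hwV (e ▸ hv)
    exact ⟨g, hg, by linarith⟩
  · intro p hp
    obtain ⟨t, ht, hpt⟩ := hc p hp
    obtain ⟨v, hv, htv⟩ := hVc t ht
    have := dist_triangle (x p) (x t) (x v)
    exact ⟨v, hv, by linarith⟩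

/-- If `k - 1` points cover the point set, the farthest point from them can be added as a
center. -/
theorem exists_certified_of_covers (hLN : ∀ i ∈ L, i < N)
    (hinj : ∀ i ∈ L, ∀ j ∈ L, x i = x j → i = j) (hne : S.Nonempty) (hS : S.card + 1 = k)
    (hL : k < L.card) (hSL : S ⊆ L) {r : ℝ}
    (hsep : ∀ v ∈ S, ∀ w ∈ S, v ≠ w → r ≤ 2 * dist (x v) (x w))
    (hc : ∀ p ∈ L, ∃ f ∈ S, 4 * dist (x p) (x f) ≤ 5 * r) :
    ∃ u, Certified x N L (insert u S) k := by
  obtain ⟨u, hu, hmax⟩ := (L \ S).exists_max_image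
    (fun p => S.inf' hne fun f => dist (x p) (x f)) (by
      rw [Finset.sdiff_nonempty]
      intro h
      have := Finset.card_le_card h
      omega)
  rw [Finset.mem_sdiff] at hu
  have hTL : insert u S ⊆ L := Finset.insert_subset hu.1 hSL
  have hTk : (insert u S).card = k := by rw [Finset.card_insert_of_notMem hu.2, hS]
  obtain ⟨i, hi, j, hj, hij, hmin⟩ := exists_closest_pair (x := x) (T := insert u S) (by
    have := hne.card_pos
    omega)
  set d := dist (x i) (x j) with hd
  have hd0 : 0 < d := dist_pos.2 fun h => hij (hinj i (hTL hi) j (hTL hj) h)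
  have hcov : ∀ p ∈ L, ∃ f ∈ insert u S, dist (x p) (x f) ≤ 5 * d := by
    intro p hp
    by_cases hpS : p ∈ S
    · exact ⟨p, Finset.mem_insert_of_mem hpS, by rw [dist_self]; linarith⟩
    have key : ∀ f ∈ S, S.inf' hne (fun f => dist (x p) (x f)) ≤ dist (x u) (x f) := fun f hf =>
      (hmax p (Finset.mem_sdiff.2 ⟨hp, hpS⟩)).trans (Finset.inf'_le _ hf)
    obtain ⟨g, hg, hpg⟩ := S.exists_mem_eq_inf' hne fun f => dist (x p) (x f)
    rw [hpg] at key
    -- If the closest pair involves `u`, then `d` is at least the covering radius of `S`, since `u`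
    -- is farthest. Otherwise `r ≤ 2 * d`, and the assumed radius `5 * r / 4` is at most `5 * d`.
    rcases Finset.mem_insert.1 hi with rfl | hi' <;> rcases Finset.mem_insert.1 hj with rfl | hj'
    · exact absurd rfl hij
    · exact ⟨g, Finset.mem_insert_of_mem hg, by linarith [key j hj']⟩
    · have := key i hi'
      rw [dist_comm (x j)] at this
      exact ⟨g, Finset.mem_insert_of_mem hg, by linarith⟩
    · obtain ⟨f, hf, hpf⟩ := hc p hp
      have := hsep i hi' j hj' hij
      exact ⟨f, Finset.mem_insert_of_mem hf, by linarith⟩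
  obtain ⟨V, hVT, -, hV, hVc⟩ := exists_net (x := x) (Finset.mem_insert_self u S) (r := 5 * d)
    (by linarith)
  refine ⟨u, d, insert u S, V, id, .of_net hLN ⟨i, hLN i (hTL hi), j, hLN j (hTL hj), rfl⟩ hd0
    hTL hTk ⟨hTL, hmin, ?_⟩ hTk (hVT.trans hTL) hV ?_ ?_⟩
  · exact fun v hv => ⟨v, hv, by rw [dist_self]; linarith⟩
  · exact fun v hv => ⟨v, hVT hv, by rw [dist_self]; linarith⟩
  · intro p hp
    obtain ⟨t, ht, hpt⟩ := hcov p hp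
    obtain ⟨v, hv, htv⟩ := hVc t ht
    have := dist_triangle (x p) (x t) (x v)
    exact ⟨v, hv, by linarith⟩

/-! ### Repairing anchors and representatives -/

/-- Anchors sharing a center would be within `s / 2`, so choosing a nearby center for each anchor is
injective. By cardinality it is onto `S`, and `ψ` is its inverse. -/
theorem Anchors.exists_near (hW : Anchors x L S s W) (hs : 0 < s) (h : S.card ≤ W.card) :
    ∃ ψ : ℕ → ℕ, (∀ f ∈ S, ψ f ∈ W ∧ 4 * dist (x (ψ f)) (x f) ≤ s) ∧ Set.InjOn ψ S := by
  choose! φ hφ hd using hW.near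
  have : ∀ f ∈ S, ∃ w ∈ W, φ w = f := by
    intro f hf
    obtain ⟨w, hw, e⟩ := Finset.surj_on_of_inj_on_of_card_le (fun w _ => φ w) hφ (by
      intro v w hv hw e
      by_contra hvw
      have h1 := hd v hv
      have h2 := hd w hw
      rw [← e] at h2
      have := dist_triangle_right (x v) (x w) (x (φ v))
      have := hW.sep v hv w hw hvw
      linarith) h f hf
    exact ⟨w, hw, e.symm⟩
  choose! ψ hψ hφψ using this
  refine ⟨ψ, fun f hf => ⟨hψ f hf, ?_⟩, fun f hf g hg e => ?_⟩
  · simpa [hφψ f hf] using hd _ (hψ f hf)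
  · rw [← hφψ f hf, e, hφψ g hg]

theorem Anchors.extend (hW : Anchors x L S s W) (hs : 0 < s) {u : ℕ} (hu : u ∈ L)
    (huW : ∀ w ∈ W, s ≤ dist (x u) (x w)) :
    Anchors x L (insert u S) s (insert u W) ∧ (insert u W).card = W.card + 1 := by
  refine ⟨⟨Finset.insert_subset hu hW.subset, ?_, ?_⟩, ?_⟩
  · intro v hv w hw hvw
    rcases Finset.mem_insert.1 hv with rfl | hv' <;> rcases Finset.mem_insert.1 hw with rfl | hw'
    · exact absurd rfl hvw
    · exact huW w hw'
    · rw [dist_comm]; exact huW v hv'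
    · exact hW.sep v hv' w hw' hvw
  · intro w hw
    rcases Finset.mem_insert.1 hw with rfl | hw'
    · exact ⟨w, Finset.mem_insert_self _ _, by rw [dist_self]; linarith⟩
    · obtain ⟨f, hf, h⟩ := hW.near w hw'
      exact ⟨f, Finset.mem_insert_of_mem hf, h⟩
  · rw [Finset.card_insert_of_notMem]
    intro h
    have := huW u h
    rw [dist_self] at this
    linarith

/-- Only `w` can rely on the center `f`: another anchor near `f` would be within `s / 2` of `w`. -/
theorem Anchors.remove (hW : Anchors x L S s W) (hs : 0 < s) {w f : ℕ} (hw : w ∈ W)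
    (hwf : 4 * dist (x w) (x f) ≤ s) {L' : Finset ℕ} (hL' : W.erase w ⊆ L') :
    Anchors x L' (S.erase f) s (W.erase w) := by
  refine ⟨hL', fun v hv w hw => hW.sep v (Finset.mem_of_mem_erase hv) w
    (Finset.mem_of_mem_erase hw), fun v hv => ?_⟩
  rw [Finset.mem_erase] at hv
  obtain ⟨g, hg, h⟩ := hW.near v hv.2
  refine ⟨g, Finset.mem_erase.2 ⟨?_, hg⟩, h⟩
  rintro rfl
  have := dist_triangle_right (x v) (x w) (x g)
  have := hW.sep v hv.2 w hw hv.1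
  linarith

/-- A partial solution with `k - 1` centers extends to a certified one. -/
theorem Anchors.exists_certified_insert (hs : 0 < s)
    (hscale : ∃ a < N, ∃ b < N, s = dist (x a) (x b)) (hLN : ∀ i ∈ L, i < N)
    (hinj : ∀ i ∈ L, ∀ j ∈ L, x i = x j → i = j) (hSL : S ⊆ L)
    (hW : Anchors x L S s W) (hWS : W.card = S.card) (hS : S.card + 1 = k) (hL : k < L.card)
    (hV : Reps x N L S s V o) (hb : b < N) (hc : CoversWith x L s V o b) :
    ∃ u, Certified x N L (insert u S) k := by
  obtain ⟨ψ, hφ, hψ⟩ := hW.exists_near hs hWS.ge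
  rcases hV.augment hs.le hLN hb hc with ⟨V, o, hV, hc⟩ | ⟨V, o, u, b, hV, hu⟩
  · by_cases hw : ∃ u ∈ L, ∀ w ∈ W, s ≤ dist (x u) (x w)
    · obtain ⟨u, hu, huW⟩ := hw
      have huS : u ∉ S := fun h => by
        have hd := (hφ u h).2
        have := huW _ (hφ u h).1
        rw [dist_comm] at this
        linarith
      have h1 := hW.extend hs hu huW
      refine ⟨u, s, insert u W, V, o, hscale, hs, Finset.insert_subset hu hSL, ?_, h1.1, by rw [h1.2, hWS, hS],
        ⟨hV.subset, hV.lt, hV.sep, hV.rep, fun v hv => ?_⟩, hc⟩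
      · rw [Finset.card_insert_of_notMem huS, hS]
      · exact (hV.real v hv).imp Finset.mem_insert_of_mem
          fun ⟨e, f, hf, h⟩ => ⟨e, f, Finset.mem_insert_of_mem hf, h⟩
    -- No further anchor exists, so all points are within `s` of an anchor and within `s + s / 4` of
    -- a center.
    · push Not at hw
      have hcov : ∀ p ∈ L, ∃ f ∈ S, 4 * dist (x p) (x f) ≤ 5 * s := by
        intro p hp
        obtain ⟨w, hwW, h⟩ := hw p hp
        obtain ⟨f, hf, hd⟩ := hW.near w hwW
        have := dist_triangle (x p) (x w) (x f)
        exact ⟨f, hf, by linarith⟩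
      refine exists_certified_of_covers hLN hinj ?_ hS hL hSL (r := s) ?_ hcov
      · obtain ⟨p, hp⟩ := Finset.card_pos.1 (by omega : 0 < L.card)
        obtain ⟨f, hf, -⟩ := hcov p hp
        exact ⟨f, hf⟩
      · intro f hf g hg hfg
        have hvf := (hφ f hf).2
        have hwg := (hφ g hg).2
        have := hW.sep _ (hφ f hf).1 _ (hφ g hg).1 fun e => hfg (hψ hf hg e)
        have := dist_triangle4 (x (ψ f)) (x f) (x g) (x (ψ g))
        rw [dist_comm (x g)] at this
        linarith
  · have huS : u ∉ S := fun h => by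
      have := hu.alone u h
      rw [dist_self] at this
      linarith
    -- Being more than `5 * s / 4` from every center puts `u` more than `s` from every anchor.
    have h1 := hW.extend hs hu.mem fun w hw => by
      obtain ⟨f, hf, hd⟩ := hW.near w hw
      have := hu.alone f hf
      have := dist_triangle (x u) (x w) (x f)
      linarith
    obtain ⟨h3, h4⟩ := hu.reps_insert hs.le hV (Finset.mem_insert_self u S) fun v hv =>
      (hV.real v hv).imp Finset.mem_insert_of_mem
        fun ⟨e, f, hf, h⟩ => ⟨e, f, Finset.mem_insert_of_mem hf, h⟩
    exact ⟨u, s, _, _, _, hscale, hs, Finset.insert_subset hu.mem hSL,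
      by rw [Finset.card_insert_of_notMem huS, hS],
      h1.1, by rw [h1.2, hWS, hS], h3, h4⟩

theorem Reps.exists_standIn (hs : 0 ≤ s) (hV : Reps x N L S s V o) :
    ∀ v ∈ V, ∃ f ∈ S, 4 * dist (x v) (x f) ≤ 5 * s := fun v hv =>
  (hV.real v hv).elim (fun h => ⟨v, h, by rw [dist_self]; linarith⟩) fun h => h.2

/-- A solution with one unserved origin can be repaired by at most one swap. -/
theorem Anchors.exists_certified_oneSwap (hs : 0 < s)
    (hscale : ∃ a < N, ∃ b < N, s = dist (x a) (x b)) (hLN : ∀ i ∈ L, i < N)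
    (hinj : ∀ i ∈ L, ∀ j ∈ L, x i = x j → i = j) (hk : 1 ≤ k) (hSL : S ⊆ L)
    (hW : Anchors x L S s W) (hWk : W.card = k) (hS : S.card = k)
    (hV : Reps x N L S s V o) (hb : b < N) (hc : CoversWith x L s V o b) :
    ∃ S', OneSwap S S' ∧ Certified x N L S' k := by
  rcases hV.augment hs.le hLN hb hc with ⟨V, o, hV, hc⟩ | ⟨V, o, u, b, hV, hu⟩
  · exact ⟨S, .refl S, s, W, V, o, hscale, hs, hSL, hS, hW, hWk, hV, hc⟩
  -- A representative that is a center stands in for itself, so a center outside the image of `ψ` is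
  -- not a representative and can be dropped.
  obtain ⟨ψ, hψ⟩ : ∃ ψ : ℕ → ℕ, ∀ v ∈ V, (v ∈ S → ψ v = v) ∧ ψ v ∈ S ∧
      4 * dist (x v) (x (ψ v)) ≤ 5 * s := by
    have : ∀ v ∈ V, ∃ f, (v ∈ S → f = v) ∧ f ∈ S ∧ 4 * dist (x v) (x f) ≤ 5 * s := by
      intro v hv
      by_cases h : v ∈ S
      · exact ⟨v, fun _ => rfl, h, by rw [dist_self]; linarith⟩
      · obtain ⟨f, hf, hd⟩ := hV.exists_standIn hs.le v hv
        exact ⟨f, fun h' => absurd h' h, hf, hd⟩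
    choose! ψ hψ using this
    exact ⟨ψ, hψ⟩
  have hinjψ : Set.InjOn ψ V := by
    intro v hv w hw e
    by_contra hvw
    have h1 := (hψ v hv).2.2
    have h2 := (hψ w hw).2.2
    rw [← e] at h2
    have := dist_triangle_right (x v) (x w) (x (ψ v))
    have := hV.sep v hv w hw hvw
    linarith
  have huS : u ∉ S := fun h => by
    have := hu.alone u h
    rw [dist_self] at this
    linarith
  have huV : u ∉ V := fun h => by
    have := hu.far u h
    rw [dist_self] at this
    linarith
  by_cases hsurj : V.image ψ = S
  · have hVk : V.card = k := by rw [← hS, ← hsurj, Finset.card_image_of_injOn hinjψ]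
    -- With `r = 5 * s` the required covering radius `5 * r` is `25 * s`, which is `10 * s` to the
    -- origin plus `15 * s` to its representative.
    refine exists_certified_of_card_succ hLN hinj hk (T := insert u V)
      (Finset.insert_subset hu.mem hV.subset)
      (by rw [Finset.card_insert_of_notMem huV, hVk]) (Finset.mem_insert_self _ _) hS hSL huS
      (r := 5 * s) ?_ ?_ ?_
    · intro v hv w hw hvw
      rcases Finset.mem_insert.1 hv with rfl | hv' <;> rcases Finset.mem_insert.1 hw with rfl | hw'
      · exact absurd rfl hvw
      · exact (hu.far w hw').le
      · rw [dist_comm]; exact (hu.far v hv').le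
      · exact (hV.sep v hv' w hw' hvw).le
    · intro v hv hvu
      exact hV.exists_standIn hs.le v (Finset.mem_of_mem_insert_of_ne hv hvu)
    · intro p hp
      rcases hu.covers p hp with ⟨v, hv, h⟩ | h
      · have := dist_triangle_right (x p) (x v) (x (o v))
        have := hV.rep v hv
        exact ⟨v, Finset.mem_insert_of_mem hv, by linarith⟩
      · have := dist_triangle_right (x p) (x u) (x b)
        have := hu.rep
        exact ⟨u, Finset.mem_insert_self _ _, by linarith⟩
  · obtain ⟨f, hf, hfV⟩ : ∃ f ∈ S, ∀ v ∈ V, ψ v ≠ f := by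
      by_contra! h
      refine hsurj (Finset.Subset.antisymm (Finset.image_subset_iff.2 fun v hv => (hψ v hv).2.1)
        fun f hf => ?_)
      obtain ⟨v, hv, e⟩ := h f hf
      exact Finset.mem_image.2 ⟨v, hv, e⟩
    obtain ⟨g, hg, -⟩ := hW.exists_near hs (by omega)
    have hgf := hg f hf
    have hW' := hW.remove hs hgf.1 hgf.2 ((Finset.erase_subset _ _).trans hW.subset)
    have hW'' := hW'.extend hs hu.mem fun w hw => by
      obtain ⟨e, he, hd⟩ := hW'.near w hw
      have := hu.alone e (Finset.mem_of_mem_erase he)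
      have := dist_triangle (x u) (x w) (x e)
      linarith
    obtain ⟨h3, h4⟩ := hu.reps_insert hs.le hV (Finset.mem_insert_self u (S.erase f)) fun v hv => by
      have hmem : ψ v ∈ insert u (S.erase f) :=
        Finset.mem_insert_of_mem (Finset.mem_erase.2 ⟨hfV v hv, (hψ v hv).2.1⟩)
      exact (hV.real v hv).imp (fun h => (hψ v hv).1 h ▸ hmem)
        fun h => ⟨h.1, ψ v, hmem, (hψ v hv).2.2⟩
    refine ⟨_, .insert_erase S f u, s, _, _, _, hscale, hs,
      Finset.insert_subset hu.mem ((Finset.erase_subset _ _).trans hSL), ?_, hW''.1, ?_, h3, h4⟩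
    · rw [Finset.card_insert_of_notMem (by simp [huS]), Finset.card_erase_of_mem hf]
      omega
    · rw [hW''.2, Finset.card_erase_of_mem hgf.1]
      omega

theorem Covers.erase {L' : Finset ℕ} (hc : Covers x L s V o) (hL : L' ⊆ L)
    (hV : Reps x N L S s V o) (hN : 0 < N) (y : ℕ) :
    ∃ b < N, CoversWith x L' s (V.erase y) o b := by
  by_cases hy : y ∈ V
  · refine ⟨o y, hV.lt y hy, fun p hp => ?_⟩
    obtain ⟨v, hv, h⟩ := hc p (hL hp)
    by_cases hvy : v = y
    · exact .inr (hvy ▸ h)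
    · exact .inl ⟨v, Finset.mem_erase.2 ⟨hvy, hv⟩, h⟩
  -- No ball is lost here, so any name below `N` can play the unserved origin.
  · refine ⟨0, hN, fun p hp => .inl ?_⟩
    rw [Finset.erase_eq_of_notMem hy]
    exact hc p (hL hp)

/-! ### Insertions and deletions -/

/-- A point that is neither center nor anchor costs at most one representative, and its ball becomes
the hole. Otherwise an anchor `w` and a nearby center `f`, one of them deleted, leave together, and
one new center replaces `f`. -/
theorem Certificate.step_delete (hC : Certificate x N L S k s W V o) (hk : 1 ≤ k)
    (hLN : ∀ i ∈ L, i < N) (hinj : ∀ i ∈ L, ∀ j ∈ L, x i = x j → i = j) {d : ℕ}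
    (hL : k < (L.erase d).card) :
    ∃ S', OneSwap S S' ∧ Certified x N (L.erase d) S' k := by
  have hL'L := Finset.erase_subset d L
  have hN : 0 < N := by
    obtain ⟨a, ha, -⟩ := hC.scale
    omega
  have hLN' : ∀ i ∈ L.erase d, i < N := fun i hi => hLN i (hL'L hi)
  have hinj' : ∀ i ∈ L.erase d, ∀ j ∈ L.erase d, x i = x j → i = j :=
    fun i hi j hj => hinj i (hL'L hi) j (hL'L hj)
  have hs := hC.pos
  have hV := hC.reps
  have hW := hC.anchors
  by_cases hd : d ∉ S ∧ d ∉ W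
  · have herase : ∀ {A : Finset ℕ}, A ⊆ L → d ∉ A → A ⊆ L.erase d := fun hA hdA i hi =>
      Finset.mem_erase.2 ⟨fun e => hdA (e ▸ hi), hA hi⟩
    obtain ⟨b, hb, hc⟩ := hC.covers.erase hL'L hV hN d
    refine Anchors.exists_certified_oneSwap hs hC.scale hLN' hinj' hk (herase hC.subset hd.1)
      ⟨herase hW.subset hd.2, hW.sep, hW.near⟩ hC.card_anchors hC.card
      (V := V.erase d) (o := o) ⟨?_, ?_, ?_, ?_, ?_⟩ hb hc
    · exact Finset.erase_subset_erase d hV.subset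
    · exact fun v hv => hV.lt v (Finset.mem_of_mem_erase hv)
    · exact fun v hv w hw => hV.sep v (Finset.mem_of_mem_erase hv) w (Finset.mem_of_mem_erase hw)
    · exact fun v hv => hV.rep v (Finset.mem_of_mem_erase hv)
    · exact fun v hv => hV.real v (Finset.mem_of_mem_erase hv)
  · obtain ⟨w, hw, f, hf, hwf, hdw, hdW, hdS⟩ : ∃ w ∈ W, ∃ f ∈ S, 4 * dist (x w) (x f) ≤ s ∧
        (d = w ∨ d = f) ∧ d ∉ W.erase w ∧ d ∉ S.erase f := by
      by_cases hdS : d ∈ S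
      · obtain ⟨ψ, hψ, -⟩ := hW.exists_near hs (hC.card.trans hC.card_anchors.symm).le
        have h := hψ d hdS
        refine ⟨ψ d, h.1, d, hdS, h.2, .inr rfl, fun h' => ?_, by simp⟩
        rw [Finset.mem_erase] at h'
        have := hW.sep _ h.1 d h'.2 h'.1.symm
        linarith
      · have hdW : d ∈ W := by tauto
        obtain ⟨f, hf, h⟩ := hW.near d hdW
        exact ⟨d, hdW, f, hf, h, .inl rfl, by simp, fun h' => hdS (Finset.mem_of_mem_erase h')⟩
    have hSL : S.erase f ⊆ L.erase d := fun i hi =>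
      Finset.mem_erase.2 ⟨fun e => hdS (e ▸ hi), hC.subset (Finset.mem_of_mem_erase hi)⟩
    have hWL : W.erase w ⊆ L.erase d := fun i hi =>
      Finset.mem_erase.2 ⟨fun e => hdW (e ▸ hi), hW.subset (Finset.mem_of_mem_erase hi)⟩
    let Valid : ℕ → Prop := fun v => v ≠ d ∧
      (v ∈ S.erase f ∨ (o v = v ∧ ∃ g ∈ S.erase f, 4 * dist (x v) (x g) ≤ 5 * s))
    have hinvalid : ∀ v ∈ V, ¬ Valid v → 4 * dist (x v) (x f) ≤ 5 * s := by
      intro v hv h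
      by_cases hvd : v = d
      · subst hvd
        rcases hdw with rfl | rfl
        · linarith
        · rw [dist_self]; linarith
      · have h' := fun h' => h ⟨hvd, h'⟩
        rcases hV.real v hv with hvS | ⟨e, g, hg, hd⟩
        · have : v = f := by
            by_contra hvf
            exact h' (.inl (Finset.mem_erase.2 ⟨hvf, hvS⟩))
          rw [this, dist_self]; linarith
        · by_cases hgf : g = f
          · rwa [← hgf]
          · exact absurd (.inr ⟨e, g, Finset.mem_erase.2 ⟨hgf, hg⟩, hd⟩) h'
    -- The invalid representatives lie within `5 * s / 4` of `f`, so two of them would violate the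
    -- separation `5 * s`.
    obtain ⟨y, hy⟩ : ∃ y, ∀ v ∈ V.erase y, Valid v := by
      by_cases h : ∀ v ∈ V, Valid v
      · exact ⟨0, fun v hv => h v (Finset.mem_of_mem_erase hv)⟩
      · push Not at h
        obtain ⟨y, hyV, hy⟩ := h
        refine ⟨y, fun v hv => ?_⟩
        by_contra hvv
        rw [Finset.mem_erase] at hv
        have := hinvalid y hyV hy
        have := hinvalid v hv.2 hvv
        have := dist_triangle_right (x v) (x y) (x f)
        have := hV.sep v hv.2 y hyV hv.1
        linarith
    obtain ⟨b, hb, hc⟩ := hC.covers.erase hL'L hV hN y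
    have hV' : Reps x N (L.erase d) (S.erase f) s (V.erase y) o :=
      ⟨fun v hv => Finset.mem_erase.2 ⟨(hy v hv).1, hV.subset (Finset.mem_of_mem_erase hv)⟩,
        fun v hv => hV.lt v (Finset.mem_of_mem_erase hv),
        fun v hv w hw => hV.sep v (Finset.mem_of_mem_erase hv) w (Finset.mem_of_mem_erase hw),
        fun v hv => hV.rep v (Finset.mem_of_mem_erase hv), fun v hv => (hy v hv).2⟩
    obtain ⟨u, hu⟩ := (hW.remove hs hw hwf hWL).exists_certified_insert hs hC.scale hLN' hinj' hSL
      (by rw [Finset.card_erase_of_mem hw, Finset.card_erase_of_mem hf, hC.card, hC.card_anchors])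
      (k := k) (by rw [Finset.card_erase_of_mem hf, hC.card]; omega) hL hV' hb hc
    exact ⟨_, .insert_erase S f u, hu⟩

/-- The old certificate survives at the same scale, with the new point as the unserved origin. -/
theorem Certificate.step_insert (hC : Certificate x N L S k s W V o) (hk : 1 ≤ k)
    (hLN : ∀ i ∈ L, i < N)
    (hinj : ∀ i ∈ insert N L, ∀ j ∈ insert N L, x i = x j → i = j) :
    ∃ S', OneSwap S S' ∧ Certified x (N + 1) (insert N L) S' k := by
  have hs := hC.pos
  have hV := hC.reps
  have hW := hC.anchors
  have hLL := Finset.subset_insert N L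
  refine Anchors.exists_certified_oneSwap hs ?_ ?_ hinj hk (hC.subset.trans hLL)
    ⟨hW.subset.trans hLL, hW.sep, hW.near⟩ hC.card_anchors hC.card (V := V) (o := o) (b := N)
    ⟨hV.subset.trans hLL, fun v hv => (hV.lt v hv).trans N.lt_succ_self, hV.sep, hV.rep, hV.real⟩
    N.lt_succ_self ?_
  · obtain ⟨a, ha, b, hb, h⟩ := hC.scale
    exact ⟨a, ha.trans N.lt_succ_self, b, hb.trans N.lt_succ_self, h⟩
  · intro i hi
    rcases Finset.mem_insert.1 hi with rfl | hi'
    · exact i.lt_succ_self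
    · exact (hLN i hi').trans N.lt_succ_self
  · intro p hp
    rcases Finset.mem_insert.1 hp with rfl | hp'
    · exact .inr (by rw [dist_self]; linarith)
    · exact .inl (hC.covers p hp')

/-- The invariant of the algorithm: all points are centers if there are at most `k` points, and
otherwise the centers are certified. -/
structure Admissible (x : ℕ → X) (N : ℕ) (L S : Finset ℕ) (k : ℕ) : Prop where
  eq : L.card ≤ k → S = L
  certified : k < L.card → Certified x N L S k

theorem Admissible.step_insert (hA : Admissible x N L S k) (hk : 1 ≤ k) (hLN : ∀ i ∈ L, i < N)
    (hinj : ∀ i ∈ insert N L, ∀ j ∈ insert N L, x i = x j → i = j) :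
    ∃ S', OneSwap S S' ∧ Admissible x (N + 1) (insert N L) S' k := by
  have hNL : N ∉ L := fun h => (hLN N h).false
  have hcard := Finset.card_insert_of_notMem hNL
  rcases lt_trichotomy L.card k with h | h | h
  · obtain rfl := hA.eq h.le
    refine ⟨insert N S, ⟨?_, ?_⟩, fun _ => rfl, fun h' => by omega⟩
    · rw [Finset.insert_sdiff_of_notMem _ hNL]; simp
    · rw [Finset.sdiff_eq_empty_iff_subset.2 (Finset.subset_insert N S)]; simp
  · obtain rfl := hA.eq h.le
    -- All `k + 1` points serve as `T`. Each covers itself and all old ones are centers, so `r = 0`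
    -- is enough.
    obtain ⟨S', h1, h2⟩ := exists_certified_of_card_succ (x := x) (N := N + 1) (T := insert N S)
      (u := N) (S := S) (k := k) (r := 0) (fun i hi => by
        rcases Finset.mem_insert.1 hi with rfl | hi'
        · exact i.lt_succ_self
        · exact (hLN i hi').trans N.lt_succ_self) hinj hk subset_rfl (by omega)
      (Finset.mem_insert_self _ _) h (Finset.subset_insert _ _) hNL
      (fun _ _ _ _ _ => dist_nonneg)
      (fun v hv hvN => ⟨v, Finset.mem_of_mem_insert_of_ne hv hvN, by simp⟩)
      (fun p hp => ⟨p, hp, by simp⟩)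
    exact ⟨S', h1, fun h' => by omega, fun _ => h2⟩
  · obtain ⟨s, W, V, o, hC⟩ := hA.certified h
    obtain ⟨S', h1, h2⟩ := hC.step_insert hk hLN hinj
    exact ⟨S', h1, fun h' => by omega, fun _ => h2⟩

theorem Admissible.step_delete (hA : Admissible x N L S k) (hk : 1 ≤ k) (hLN : ∀ i ∈ L, i < N)
    (hinj : ∀ i ∈ L, ∀ j ∈ L, x i = x j → i = j) {d : ℕ} (hd : d ∈ L) :
    ∃ S', OneSwap S S' ∧ Admissible x N (L.erase d) S' k := by
  have hcard := Finset.card_erase_of_mem hd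
  have hpos := Finset.card_pos.2 ⟨d, hd⟩
  rcases le_or_gt (L.erase d).card k with h | h
  · refine ⟨L.erase d, ?_, fun _ => rfl, fun h' => by omega⟩
    rcases le_or_gt L.card k with h' | h'
    · obtain rfl := hA.eq h'
      constructor
      · simp [Finset.sdiff_eq_empty_iff_subset.2 (Finset.erase_subset d S)]
      · rw [Finset.sdiff_erase hd]; simp
    -- Here `L` has exactly `k + 1` points, so only one point was not a center.
    · obtain ⟨s, W, V, o, hC⟩ := hA.certified h'
      constructor
      · refine (Finset.card_le_card (Finset.sdiff_subset_sdiff (Finset.erase_subset d L)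
          subset_rfl)).trans ?_
        rw [Finset.card_sdiff_of_subset hC.subset, hC.card]
        omega
      · refine (Finset.card_le_card (t := {d}) fun i hi => ?_).trans (by simp)
        rw [Finset.mem_sdiff, Finset.mem_erase] at hi
        rw [Finset.mem_singleton]
        by_contra hid
        exact hi.2 ⟨hid, hC.subset hi.1⟩
  · obtain ⟨s, W, V, o, hC⟩ := hA.certified (by omega)
    obtain ⟨S', h1, h2⟩ := hC.step_delete hk hLN hinj h
    exact ⟨S', h1, fun h' => by omega, fun _ => h2⟩

/-- The first `n₀` points have admissible centers. -/
theorem exists_admissible_range (hk : 1 ≤ k) (n₀ : ℕ)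
    (hinj : ∀ i < n₀, ∀ j < n₀, x i = x j → i = j) :
    ∃ S, Admissible x n₀ (Finset.range n₀) S k := by
  induction n₀ with
  | zero => exact ⟨∅, fun _ => by simp, fun h => by simp at h⟩
  | succ n ih =>
    obtain ⟨S, hS⟩ := ih fun i hi j hj => hinj i (by omega) j (by omega)
    obtain ⟨S', -, h⟩ := hS.step_insert hk (fun i hi => Finset.mem_range.1 hi) (by
      rw [← Finset.range_add_one]
      exact fun i hi j hj => hinj i (Finset.mem_range.1 hi) j (Finset.mem_range.1 hj))
    exact ⟨S', by rwa [Finset.range_add_one]⟩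

/-! ### The approximation guarantee -/

theorem Certificate.exists_dist_le (hC : Certificate x N L S k s W V o) {Q : Finset X}
    (hQ : Q.card ≤ k) {R : ℝ} (hR : ∀ p ∈ L, ∃ q ∈ Q, dist (x p) q ≤ R) :
    ∀ p ∈ L, ∃ f ∈ S, dist (x p) (x f) ≤ 50 * R := by
  have hs := hC.pos
  intro p hp
  by_cases h : s ≤ 2 * R
  · obtain ⟨v, hv, hpv⟩ := hC.covers p hp
    rcases hC.reps.real v hv with hvS | ⟨e, f, hf, hvf⟩
    · have := hC.reps.rep v hv
      have := dist_triangle_right (x p) (x v) (x (o v))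
      exact ⟨v, hvS, by linarith⟩
    · rw [e] at hpv
      have := dist_triangle (x p) (x v) (x f)
      exact ⟨f, hf, by linarith⟩
  · push Not at h
    have : Nonempty X := ⟨x 0⟩
    choose! q hqQ hq using hR
    have hsame : ∀ i ∈ L, ∀ j ∈ L, q i = q j → dist (x i) (x j) ≤ 2 * R := by
      intro i hi j hj e
      have h1 := hq i hi
      have h2 := hq j hj
      rw [← e] at h2
      have := dist_triangle_right (x i) (x j) (q i)
      linarith
    -- Anchors are more than `2 * R` apart, so they occupy different clusters of `Q`; with `k`
    -- anchors no cluster is left out.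
    have hsurj : ∀ z ∈ Q, ∃ w ∈ W, q w = z := by
      intro z hz
      obtain ⟨w, hw, e⟩ := Finset.surj_on_of_inj_on_of_card_le (fun w _ => q w)
        (fun w hw => hqQ w (hC.anchors.subset hw)) (by
          intro v w hv hw e
          by_contra hvw
          have := hsame v (hC.anchors.subset hv) w (hC.anchors.subset hw) e
          have := hC.anchors.sep v hv w hw hvw
          linarith) (hQ.trans hC.card_anchors.ge) z hz
      exact ⟨w, hw, e.symm⟩
    obtain ⟨w, hw, e⟩ := hsurj (q p) (hqQ p hp)
    have hwL := hC.anchors.subset hw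
    have hpw := hsame p hp w hwL e.symm
    obtain ⟨f, hf, hwf⟩ := hC.anchors.near w hw
    refine ⟨f, hf, ?_⟩
    have hfL := hC.subset hf
    by_cases h' : s ≤ 4 * R
    · have := dist_triangle (x p) (x w) (x f)
      linarith
    -- Now the center `f` is in the cluster of `p`: the anchor `v` of the cluster of `f` is within
    -- `2 * R + s / 4 < s` of `w`, so it is `w`.
    · push Not at h'
      obtain ⟨v, hv, e'⟩ := hsurj (q f) (hqQ f hfL)
      have hfv := hsame v (hC.anchors.subset hv) f hfL e'
      have hvw : v = w := by
        by_contra hvw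
        have := hC.anchors.sep v hv w hw hvw
        have := dist_triangle_right (x v) (x w) (x f)
        linarith
      subst hvw
      have := hsame p hp f hfL (e.symm.trans e')
      have := dist_nonneg.trans this
      linarith

theorem mem_pointsOf {Y : Type*} {x : ℕ → Y} {L : Finset ℕ} {p : Y} : p ∈ pointsOf x L ↔ ∃ i ∈ L, x i = p := by
  classical
  simp [pointsOf]

theorem Admissible.subset (hA : Admissible x N L S k) : S ⊆ L := by
  rcases le_or_gt L.card k with h | h
  · exact (hA.eq h).subset
  · obtain ⟨s, W, V, o, hC⟩ := hA.certified h
    exact hC.subset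

theorem Admissible.isDominatingSet (hA : Admissible x N L S k) :
    IsDominatingSet (pointsOf x L) (pointsOf x S) (50 * optRadius (pointsOf x L) k) := by
  classical
  refine ⟨fun p hp => ?_, fun p hp => ?_⟩
  · obtain ⟨i, hi, rfl⟩ := mem_pointsOf.1 hp
    exact mem_pointsOf.2 ⟨i, hA.subset hi, rfl⟩
  rcases le_or_gt L.card k with h | h
  · rw [hA.eq h, Metric.infEDist_zero_of_mem (Finset.mem_coe.2 hp)]
    exact zero_le
  · obtain ⟨s, W, V, o, hC⟩ := hA.certified h
    -- Dividing by `50` isolates the infimum, so that each competitor `Q` can be treated separately.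
    rw [mul_comm, ← ENNReal.div_le_iff_le_mul (by simp) (by simp)]
    refine le_iInf₂ fun Q hQ => ?_
    rw [ENNReal.div_le_iff_le_mul (by simp) (by simp), mul_comm]
    by_cases hc : cost (pointsOf x L) Q = ⊤
    · simp [hc]
    have hcost : ∀ i ∈ L, Metric.infEDist (x i) (Q : Set X) ≤ cost (pointsOf x L) Q := fun i hi =>
      le_iSup₂ (f := fun p (_ : p ∈ pointsOf x L) => Metric.infEDist p (Q : Set X)) (x i)
        (mem_pointsOf.2 ⟨i, hi, rfl⟩)
    have hR : ∀ i ∈ L, ∃ q ∈ Q, dist (x i) q ≤ (cost (pointsOf x L) Q).toReal := by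
      intro i hi
      have hne : (Q : Set X).Nonempty := by
        by_contra hne
        rw [Set.not_nonempty_iff_eq_empty] at hne
        have := hcost i hi
        rw [hne, Metric.infEDist_empty, top_le_iff] at this
        exact hc this
      obtain ⟨q, hq, e⟩ := Q.finite_toSet.isCompact.exists_infEDist_eq_edist hne (x i)
      refine ⟨q, hq, ?_⟩
      rw [dist_edist]
      exact ENNReal.toReal_mono hc (e ▸ hcost i hi)
    obtain ⟨i, hi, rfl⟩ := mem_pointsOf.1 hp
    obtain ⟨f, hf, hd⟩ := hC.exists_dist_le hQ.2 hR i hi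
    refine (Metric.infEDist_le_edist_of_mem (y := x f)
      (Finset.mem_coe.2 (mem_pointsOf.2 ⟨f, hf, rfl⟩))).trans ?_
    rw [edist_dist]
    refine (ENNReal.ofReal_le_ofReal hd).trans ?_
    rw [ENNReal.ofReal_mul (by norm_num), ENNReal.ofReal_toReal hc]
    simp

end Certificate

/-! ### The algorithm -/

/-- The answer to the comparison `m * dist(a, b) ≤ n * dist(c, d)` is known to be `v`. The answers
are listed in the order of the codes of the comparisons. -/
def Knows (ans : List Bool) (m a b n c d : ℕ) (v : Bool) : Prop :=
  ans[Encodable.encode (⟨m, a, b, n, c, d⟩ : Comparison)]? = some v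

/-- The answers imply that `S` is certified, with scale `dist(a, b)`, anchors `W`, representatives
`V`, and origins listed in `l`. -/
structure CertCheck (k N : ℕ) (live : List ℕ) (ans : List Bool) (S : List ℕ) (a b : ℕ)
    (W V l : List ℕ) : Prop where
  scale : a < N ∧ b < N ∧ Knows ans 1 a b 0 a b false
  centers : S.length = k ∧ ∀ i ∈ S, i ∈ live
  anchors : W.Nodup ∧ W.length = k ∧ ∀ w ∈ W, w ∈ live ∧
    (∀ v ∈ W, v = w ∨ Knows ans 1 a b 1 v w true) ∧ ∃ f ∈ S, Knows ans 4 w f 1 a b true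
  reps : ∀ v ∈ V, v ∈ live ∧ l.getD v 0 < N ∧ (∀ w ∈ V, v = w ∨ Knows ans 1 v w 5 a b false) ∧
    Knows ans 1 v (l.getD v 0) 15 a b true ∧
    (v ∈ S ∨ (l.getD v 0 = v ∧ ∃ f ∈ S, Knows ans 4 v f 5 a b true))
  covers : ∀ p ∈ live, ∃ v ∈ V, Knows ans 1 p (l.getD v 0) 10 a b true

/-- A candidate: a list of centers, a scale, anchors, representatives and origins. -/
abbrev Candidate := List ℕ × (ℕ × ℕ) × List ℕ × List ℕ × List ℕ

/-- What the algorithm remembers: the number of points that have arrived, the current points, the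
last centers, the answers received since the last update, and the phase (`0`: before the first
output, `1`: processing an update, `2`: finished). -/
abbrev Memory := ℕ × List ℕ × List ℕ × List Bool × ℕ

/-- The candidate can be announced. -/
structure Check (k : ℕ) (M : Memory) (c : Candidate) : Prop where
  nodup : c.1.Nodup
  swap : M.2.2.2.2 = 0 ∨ (∀ i ∈ c.1, ∀ j ∈ c.1, i ∈ M.2.2.1 ∨ j ∈ M.2.2.1 ∨ i = j) ∧
    ∀ i ∈ M.2.2.1, ∀ j ∈ M.2.2.1, i ∈ c.1 ∨ j ∈ c.1 ∨ i = j
  good : (M.2.1.length ≤ k ∧ (∀ i ∈ c.1, i ∈ M.2.1) ∧ ∀ i ∈ M.2.1, i ∈ c.1) ∨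
    (k < M.2.1.length ∧
      CertCheck k M.1 M.2.1 M.2.2.2.1 c.1 c.2.1.1 c.2.1.2 c.2.2.1 c.2.2.2.1 c.2.2.2.2)

/-! ### Primitive recursiveness of the check -/

section Primrec

variable {α : Type*} [Primcodable α]

theorem primrec_comparison : Primrec fun z : (ℕ × ℕ × ℕ) × (ℕ × ℕ × ℕ) =>
    (⟨z.1.1, z.1.2.1, z.1.2.2, z.2.1, z.2.2.1, z.2.2.2⟩ : Comparison) :=
  Primrec.of_equiv_symm (e := Comparison.equiv)

theorem primrecPred_knows {ans : α → List Bool} {m a b n c d : α → ℕ} (v : Bool)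
    (hans : Primrec ans) (hm : Primrec m) (ha : Primrec a) (hb : Primrec b) (hn : Primrec n)
    (hc : Primrec c) (hd : Primrec d) :
    PrimrecPred fun z => Knows (ans z) (m z) (a z) (b z) (n z) (c z) (d z) v :=
  Primrec.eq.comp (Primrec.list_getElem?.comp hans (Primrec.encode.comp
    (primrec_comparison.comp ((hm.pair (ha.pair hb)).pair (hn.pair (hc.pair hd))))))
    (Primrec.const _)

theorem primrecPred_certCheck {k N a b : α → ℕ} {live S W V l : α → List ℕ} {ans : α → List Bool}
    (hk : Primrec k) (hN : Primrec N) (hlive : Primrec live) (hans : Primrec ans) (hS : Primrec S)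
    (ha : Primrec a) (hb : Primrec b) (hW : Primrec W) (hV : Primrec V) (hl : Primrec l) :
    PrimrecPred fun z =>
      CertCheck (k z) (N z) (live z) (ans z) (S z) (a z) (b z) (W z) (V z) (l z) := by
  have hc (n : ℕ) {β : Type _} [Primcodable β] : Primrec fun _ : β => n := Primrec.const n
  have f1 {β : Type} [Primcodable β] {f : α → β} (hf : Primrec f) :
      Primrec fun z : α × ℕ => f z.1 := hf.comp Primrec.fst
  have f2 {β : Type} [Primcodable β] {f : α × ℕ → β} (hf : Primrec f) :
      Primrec fun z : (α × ℕ) × ℕ => f z.1 := hf.comp Primrec.fst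
  have s1 : Primrec fun z : α × ℕ => z.2 := Primrec.snd
  have s2 : Primrec fun z : (α × ℕ) × ℕ => z.2 := Primrec.snd
  have hl1 : Primrec fun z : α × ℕ => (l z.1).getD z.2 0 := (Primrec.list_getD 0).comp (f1 hl) s1
  have hl2 : Primrec fun z : (α × ℕ) × ℕ => (l z.1.1).getD z.2 0 :=
    (Primrec.list_getD 0).comp (f2 (f1 hl)) s2
  have h1 : PrimrecPred fun z => a z < N z ∧ b z < N z ∧
      Knows (ans z) 1 (a z) (b z) 0 (a z) (b z) false :=
    (Primrec.nat_lt.comp ha hN).and ((Primrec.nat_lt.comp hb hN).and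
      (primrecPred_knows _ hans (hc 1) ha hb (hc 0) ha hb))
  have h2 : PrimrecPred fun z => (S z).length = k z ∧ ∀ i ∈ S z, i ∈ live z :=
    (Primrec.eq.comp (Primrec.list_length.comp hS) hk).and
      (PrimrecPred.forall_mem hS (PrimrecPred.mem s1 (f1 hlive)))
  have h3 : PrimrecPred fun z => (W z).Nodup ∧ (W z).length = k z ∧ ∀ w ∈ W z, w ∈ live z ∧
      (∀ v ∈ W z, v = w ∨ Knows (ans z) 1 (a z) (b z) 1 v w true) ∧
      ∃ f ∈ S z, Knows (ans z) 4 w f 1 (a z) (b z) true :=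
    (PrimrecPred.nodup hW).and ((Primrec.eq.comp (Primrec.list_length.comp hW) hk).and
      (PrimrecPred.forall_mem hW ((PrimrecPred.mem s1 (f1 hlive)).and
        ((PrimrecPred.forall_mem (p := fun (z : α × ℕ) v => v = z.2 ∨
          Knows (ans z.1) 1 (a z.1) (b z.1) 1 v z.2 true) (f1 hW) ((Primrec.eq.comp s2 (f2 s1)).or
          (primrecPred_knows _ (f2 (f1 hans)) (hc 1) (f2 (f1 ha)) (f2 (f1 hb)) (hc 1) s2
            (f2 s1)))).and
        (PrimrecPred.exists_mem (p := fun (z : α × ℕ) f =>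
          Knows (ans z.1) 4 z.2 f 1 (a z.1) (b z.1) true) (f1 hS)
          (primrecPred_knows _ (f2 (f1 hans)) (hc 4) (f2 s1) s2 (hc 1) (f2 (f1 ha))
            (f2 (f1 hb))))))))
  have h4 : PrimrecPred fun z => ∀ v ∈ V z, v ∈ live z ∧ (l z).getD v 0 < N z ∧
      (∀ w ∈ V z, v = w ∨ Knows (ans z) 1 v w 5 (a z) (b z) false) ∧
      Knows (ans z) 1 v ((l z).getD v 0) 15 (a z) (b z) true ∧
      (v ∈ S z ∨ ((l z).getD v 0 = v ∧ ∃ f ∈ S z, Knows (ans z) 4 v f 5 (a z) (b z) true)) :=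
    PrimrecPred.forall_mem hV ((PrimrecPred.mem s1 (f1 hlive)).and
      ((Primrec.nat_lt.comp hl1 (f1 hN)).and
      ((PrimrecPred.forall_mem (p := fun (z : α × ℕ) w => z.2 = w ∨
          Knows (ans z.1) 1 z.2 w 5 (a z.1) (b z.1) false) (f1 hV)
        ((Primrec.eq.comp (f2 s1) s2).or (primrecPred_knows _ (f2 (f1 hans)) (hc 1) (f2 s1) s2
          (hc 5) (f2 (f1 ha)) (f2 (f1 hb))))).and
      ((primrecPred_knows _ (f1 hans) (hc 1) s1 hl1 (hc 15) (f1 ha) (f1 hb)).and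
      ((PrimrecPred.mem s1 (f1 hS)).or ((Primrec.eq.comp hl1 s1).and
        (PrimrecPred.exists_mem (p := fun (z : α × ℕ) f =>
          Knows (ans z.1) 4 z.2 f 5 (a z.1) (b z.1) true) (f1 hS)
          (primrecPred_knows _ (f2 (f1 hans)) (hc 4) (f2 s1) s2 (hc 5) (f2 (f1 ha))
            (f2 (f1 hb))))))))))
  have h5 : PrimrecPred fun z => ∀ p ∈ live z, ∃ v ∈ V z,
      Knows (ans z) 1 p ((l z).getD v 0) 10 (a z) (b z) true :=
    PrimrecPred.forall_mem hlive (PrimrecPred.exists_mem (p := fun (z : α × ℕ) v =>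
      Knows (ans z.1) 1 z.2 ((l z.1).getD v 0) 10 (a z.1) (b z.1) true) (f1 hV)
      (primrecPred_knows _ (f2 (f1 hans)) (hc 1) (f2 s1) hl2 (hc 10) (f2 (f1 ha)) (f2 (f1 hb))))
  exact (h1.and (h2.and (h3.and (h4.and h5)))).of_eq fun z =>
    ⟨fun h => ⟨h.1, h.2.1, h.2.2.1, h.2.2.2.1, h.2.2.2.2⟩, fun h => ⟨h.1, h.2, h.3, h.4, h.5⟩⟩

theorem primrecPred_pairwise {S T : α → List ℕ} (hS : Primrec S) (hT : Primrec T) :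
    PrimrecPred fun z => ∀ i ∈ T z, ∀ j ∈ T z, i ∈ S z ∨ j ∈ S z ∨ i = j :=
  PrimrecPred.forall_mem hT (PrimrecPred.forall_mem (p := fun (z : α × ℕ) j => z.2 ∈ S z.1 ∨
    j ∈ S z.1 ∨ z.2 = j) (hT.comp Primrec.fst)
    ((PrimrecPred.mem (Primrec.snd.comp Primrec.fst) (hS.comp (Primrec.fst.comp Primrec.fst))).or
      ((PrimrecPred.mem Primrec.snd (hS.comp (Primrec.fst.comp Primrec.fst))).or
        (Primrec.eq.comp (Primrec.snd.comp Primrec.fst) Primrec.snd))))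

theorem primrecPred_subset {S T : α → List ℕ} (hS : Primrec S) (hT : Primrec T) :
    PrimrecPred fun z => ∀ i ∈ S z, i ∈ T z :=
  PrimrecPred.forall_mem hS (PrimrecPred.mem Primrec.snd (hT.comp Primrec.fst))

theorem primrecPred_check {k : α → ℕ} {M : α → Memory} {c : α → Candidate} (hk : Primrec k)
    (hM : Primrec M) (hc : Primrec c) : PrimrecPred fun z => Check (k z) (M z) (c z) := by
  have hN := Primrec.fst.comp hM
  have hM2 := Primrec.snd.comp hM
  have hlive := Primrec.fst.comp hM2
  have hM3 := Primrec.snd.comp hM2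
  have hS := Primrec.fst.comp hM3
  have hM4 := Primrec.snd.comp hM3
  have hans := Primrec.fst.comp hM4
  have hph := Primrec.snd.comp hM4
  have hT := Primrec.fst.comp hc
  have hc2 := Primrec.snd.comp hc
  have hab := Primrec.fst.comp hc2
  have hc3 := Primrec.snd.comp hc2
  have hW := Primrec.fst.comp hc3
  have hc4 := Primrec.snd.comp hc3
  have hlen := Primrec.list_length.comp hlive
  have h := (PrimrecPred.nodup hT).and
    (((Primrec.eq.comp hph (Primrec.const 0)).or
      ((primrecPred_pairwise hS hT).and (primrecPred_pairwise hT hS))).and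
    (((Primrec.nat_le.comp hlen hk).and
      ((primrecPred_subset hT hlive).and (primrecPred_subset hlive hT))).or
    ((Primrec.nat_lt.comp hk hlen).and (primrecPred_certCheck hk hN hlive hans hT
      (Primrec.fst.comp hab) (Primrec.snd.comp hab) hW (Primrec.fst.comp hc4)
      (Primrec.snd.comp hc4)))))
  exact h.of_eq fun z => ⟨fun h => ⟨h.1, h.2.1, h.2.2⟩, fun h => ⟨h.1, h.2, h.3⟩⟩

end Primrec

/-- The `i`-th comparison. -/
def question (i : ℕ) : Comparison :=
  ((Encodable.decode i : Option Comparison)).getD ⟨0, 0, 0, 0, 0, 0⟩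

/-- The candidate that is tested after `j` answers; every candidate is tested infinitely often. -/
def candidate (j : ℕ) : Candidate :=
  ((Encodable.decode j.unpair.1 : Option Candidate)).getD ([], (0, 0), [], [], [])

/-- The phase is finished if the next candidate can be announced. -/
noncomputable def test (k : ℕ) (M : Memory) : Memory :=
  open Classical in
  if Check k M (candidate M.2.2.2.1.length) then
    (M.1, M.2.1, (candidate M.2.2.2.1.length).1, M.2.2.2.1, 2)
  else M

def insertStep (M : Memory) : Memory :=
  (M.1 + 1, M.1 :: M.2.1, M.2.2.1, [], 1)

def deleteStep (M : Memory) (i : ℕ) : Memory :=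
  (M.1, M.2.1.filter (fun j => ¬ j = i), M.2.2.1, [], 1)

def updateStep (M : Memory) : Update → Memory
  | .insert => insertStep M
  | .delete i => deleteStep M i

def recordStep (M : Memory) (v : Bool) : Memory :=
  (M.1, M.2.1, M.2.2.1, M.2.2.2.1 ++ [v], M.2.2.2.2)

noncomputable def step (k : ℕ) (M : Memory) : Message → Memory
  | .update u => updateStep M u
  | .answer v => test k (recordStep M v)

noncomputable def memory (k n₀ : ℕ) (h : List Message) : Memory :=
  h.foldr (fun m M => step k M m) (n₀, List.range n₀, [], [], 0)

noncomputable def act (M : Memory) : Action :=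
  if M.2.2.2.2 = 2 then .output M.2.2.1 else .ask (question M.2.2.2.1.length)

/-! ### Primitive recursiveness of the transition -/

theorem primrec_test : Primrec fun z : ℕ × Memory => test z.1 z.2 := by
  classical
  have hM : Primrec fun z : ℕ × Memory => z.2 := Primrec.snd
  have hans : Primrec fun z : ℕ × Memory => z.2.2.2.2.1 :=
    Primrec.fst.comp (Primrec.snd.comp (Primrec.snd.comp (Primrec.snd.comp hM)))
  have hc : Primrec fun z : ℕ × Memory => candidate z.2.2.2.2.1.length :=
    Primrec.option_getD.comp (Primrec.decode.comp (Primrec.fst.comp (Primrec.unpair.comp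
      (Primrec.list_length.comp hans)))) (Primrec.const _)
  refine (Primrec.ite (primrecPred_check Primrec.fst hM hc) ((Primrec.fst.comp hM).pair
    ((Primrec.fst.comp (Primrec.snd.comp hM)).pair ((Primrec.fst.comp hc).pair
      (hans.pair (Primrec.const 2))))) hM).of_eq fun z => ?_
  unfold test
  congr

theorem primrec_filter_ne : Primrec₂ fun (l : List ℕ) (i : ℕ) => l.filter fun j => ¬ j = i :=
  PrimrecRel.listFilter (R := fun j i : ℕ => ¬ j = i) Primrec.eq.not

theorem primrec_insertStep : Primrec insertStep :=
  have h3 : Primrec fun M : Memory => M.2.2 := Primrec.snd.comp Primrec.snd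
  (Primrec.succ.comp Primrec.fst).pair
    ((Primrec.list_cons.comp Primrec.fst (Primrec.fst.comp Primrec.snd)).pair
      ((Primrec.fst.comp h3).pair (Primrec.const ([], 1))))

theorem primrec_deleteStep : Primrec₂ deleteStep :=
  have h1 : Primrec fun z : Memory × ℕ => z.1 := Primrec.fst
  have h2 := Primrec.snd.comp h1
  have h3 := Primrec.snd.comp h2
  (Primrec.fst.comp h1).pair
    ((primrec_filter_ne.comp (Primrec.fst.comp h2) Primrec.snd).pair
      ((Primrec.fst.comp h3).pair (Primrec.const ([], 1))))

theorem primrec_recordStep : Primrec₂ recordStep :=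
  have h1 : Primrec fun z : Memory × Bool => z.1 := Primrec.fst
  have h2 := Primrec.snd.comp h1
  have h3 := Primrec.snd.comp h2
  have h4 := Primrec.snd.comp h3
  (Primrec.fst.comp h1).pair ((Primrec.fst.comp h2).pair ((Primrec.fst.comp h3).pair
    ((Primrec.list_concat.comp (Primrec.fst.comp h4) Primrec.snd).pair (Primrec.snd.comp h4))))

theorem primrec_updateStep : Primrec₂ updateStep := by
  refine (Primrec.option_casesOn (o := fun z : Memory × Update => Update.equiv z.2)
    (f := fun z => insertStep z.1) (g := fun z i => deleteStep z.1 i)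
    ((Primrec.of_equiv (e := Update.equiv)).comp Primrec.snd)
    (primrec_insertStep.comp Primrec.fst)
    (primrec_deleteStep.comp (Primrec.fst.comp Primrec.fst) Primrec.snd)).of_eq ?_
  rintro ⟨M, _ | i⟩ <;> rfl

theorem primrec_answerStep :
    Primrec fun z : (ℕ × Memory) × Bool => test z.1.1 (recordStep z.1.2 z.2) :=
  Primrec.comp (f := fun z : ℕ × Memory => test z.1 z.2)
    (g := fun z : (ℕ × Memory) × Bool => (z.1.1, recordStep z.1.2 z.2)) primrec_test
    ((Primrec.fst.comp Primrec.fst).pair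
      (primrec_recordStep.comp (Primrec.snd.comp Primrec.fst) Primrec.snd))

theorem primrec_step : Primrec fun z : (ℕ × Memory) × Message => step z.1.1 z.1.2 z.2 := by
  have h1 : Primrec₂ fun (z : (ℕ × Memory) × Message) (u : Update) => updateStep z.1.2 u :=
    primrec_updateStep.comp (Primrec.snd.comp (Primrec.fst.comp Primrec.fst)) Primrec.snd
  have h2 : Primrec₂ fun (z : (ℕ × Memory) × Message) (v : Bool) =>
      test z.1.1 (recordStep z.1.2 v) :=
    Primrec.comp (f := fun z : (ℕ × Memory) × Bool => test z.1.1 (recordStep z.1.2 z.2))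
      (g := fun z : ((ℕ × Memory) × Message) × Bool => (z.1.1, z.2)) primrec_answerStep
      ((Primrec.fst.comp Primrec.fst).pair Primrec.snd)
  have h3 : Primrec fun z : (ℕ × Memory) × Message => Message.equiv z.2 :=
    (Primrec.of_equiv (e := Message.equiv)).comp Primrec.snd
  refine (Primrec.sumCasesOn h3 h1 h2).of_eq ?_
  rintro ⟨z, u | v⟩ <;> rfl

theorem primrec_act : Primrec act := by
  have h3 : Primrec fun M : Memory => M.2.2 := Primrec.snd.comp Primrec.snd
  have h4 := Primrec.snd.comp h3
  have hq : Primrec fun M : Memory => question M.2.2.2.1.length :=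
    Primrec.option_getD.comp (Primrec.decode.comp (Primrec.list_length.comp (Primrec.fst.comp h4)))
      (Primrec.const _)
  have hout : Primrec fun S : List ℕ => Action.output S :=
    (Primrec.of_equiv_symm (e := Action.equiv)).comp Primrec.sumInr
  have hask : Primrec fun q : Comparison => Action.ask q :=
    (Primrec.of_equiv_symm (e := Action.equiv)).comp Primrec.sumInl
  exact Primrec.ite (Primrec.eq.comp (Primrec.snd.comp h4) (Primrec.const 2))
    (hout.comp (Primrec.fst.comp h3)) (hask.comp hq)

theorem primrec_memory : Primrec fun z : ℕ × ℕ × List Message => memory z.1 z.2.1 z.2.2 := by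
  have hn : Primrec fun z : ℕ × ℕ × List Message => z.2.1 := Primrec.fst.comp Primrec.snd
  refine Primrec.list_foldr (f := fun z : ℕ × ℕ × List Message => z.2.2)
    (g := fun z => ((z.2.1, List.range z.2.1, [], [], 0) : Memory))
    (h := fun z p => step z.1 p.2 p.1) (Primrec.snd.comp Primrec.snd)
    (hn.pair ((Primrec.list_range.comp hn).pair (Primrec.const _))) ?_
  exact primrec_step.comp (((Primrec.fst.comp Primrec.fst).pair
    (Primrec.snd.comp Primrec.snd)).pair (Primrec.fst.comp Primrec.snd))

/-- The algorithm asks all comparisons in turn and tests all candidates for a certified set of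
centers, until it finds one that differs from the last centers by at most one swap. -/
noncomputable def algorithm : DynamicAlgorithm where
  next k n₀ h := act (memory k n₀ h)
  computable := (primrec_act.comp primrec_memory).to_comp

/-! ### Truthful answers and termination of the search -/

section Run

variable {X : Type*} [MetricSpace X]
variable {x : ℕ → X} {N k n₀ : ℕ}

/-- The truthful answers to the first `j` comparisons. -/
noncomputable def truth (x : ℕ → X) (N j : ℕ) : List Bool :=
  (List.range j).map fun i => (question i).eval x N

theorem length_truth (x : ℕ → X) (N j : ℕ) : (truth x N j).length = j := by simp [truth]

theorem truth_succ (x : ℕ → X) (N j : ℕ) :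
    truth x N (j + 1) = truth x N j ++ [(question j).eval x N] := by
  simp [truth, List.range_succ]

theorem knows_truth {j m a b n c d : ℕ} {v : Bool} : Knows (truth x N j) m a b n c d v ↔
    Encodable.encode (⟨m, a, b, n, c, d⟩ : Comparison) < j ∧
      Comparison.eval x N ⟨m, a, b, n, c, d⟩ = v := by
  rw [Knows, truth, List.getElem?_map, Option.map_eq_some_iff]
  simp only [List.getElem?_eq_some_iff, List.getElem_range, List.length_range]
  constructor
  · rintro ⟨i, ⟨h, rfl⟩, e⟩
    exact ⟨h, by simpa [question, Encodable.encodek] using e⟩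
  · rintro ⟨h, e⟩
    exact ⟨_, ⟨h, rfl⟩, by simpa [question, Encodable.encodek] using e⟩

theorem Knows.le {j m a b n c d : ℕ} (h : Knows (truth x N j) m a b n c d true) :
    (m : ℝ) * dist (x a) (x b) ≤ n * dist (x c) (x d) := by
  have := (knows_truth.1 h).2
  rw [Comparison.eval, decide_eq_true_eq] at this
  exact this.2

/-- Questions about points that have not arrived are also answered `false`, so a negative answer is
informative only under the four bounds. -/
theorem Knows.lt {j m a b n c d : ℕ} (h : Knows (truth x N j) m a b n c d false) (ha : a < N)
    (hb : b < N) (hc : c < N) (hd : d < N) :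
    (n : ℝ) * dist (x c) (x d) < m * dist (x a) (x b) := by
  have := (knows_truth.1 h).2
  rw [Comparison.eval, decide_eq_false_iff_not, not_and] at this
  exact not_le.1 (this ⟨ha, hb, hc, hd⟩)

/-- Only finitely many comparisons have coefficients below `16` and involve arrived points, so their
codes are bounded. The largest coefficient in a certificate is `15`. -/
theorem exists_knows (x : ℕ → X) (N : ℕ) : ∃ J, ∀ j ≥ J, ∀ a < N, ∀ b < N, ∀ c < N, ∀ d < N,
    ∀ m : ℕ, m < 16 → ∀ n : ℕ, n < 16 →
    ((m : ℝ) * dist (x a) (x b) ≤ n * dist (x c) (x d) → Knows (truth x N j) m a b n c d true) ∧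
    ((n : ℝ) * dist (x c) (x d) < m * dist (x a) (x b) →
      Knows (truth x N j) m a b n c d false) := by
  obtain ⟨J, hJ⟩ := Finset.exists_nat_subset_range
    (((Finset.range 16 ×ˢ Finset.range N ×ˢ Finset.range N) ×ˢ
      (Finset.range 16 ×ˢ Finset.range N ×ˢ Finset.range N)).image
        fun z => Encodable.encode (Comparison.equiv.symm z))
  refine ⟨J, fun j hj a ha b hb c hc d hd m hm n hn => ?_⟩
  have hlt : Encodable.encode (⟨m, a, b, n, c, d⟩ : Comparison) < j := by
    refine (Finset.mem_range.1 (hJ (Finset.mem_image.2 ⟨((m, a, b), (n, c, d)), ?_, rfl⟩))).trans_le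
      hj
    simp [ha, hb, hc, hd, hm, hn]
  refine ⟨fun h => knows_truth.2 ⟨hlt, ?_⟩, fun h => knows_truth.2 ⟨hlt, ?_⟩⟩
  · rw [Comparison.eval, decide_eq_true_eq]
    exact ⟨⟨ha, hb, hc, hd⟩, h⟩
  · rw [Comparison.eval, decide_eq_false_iff_not]
    exact fun h' => not_le.2 h h'.2

theorem CertCheck.certificate {live S W V l : List ℕ} {a b j : ℕ} (hN : ∀ i ∈ live, i < N)
    (hS : S.Nodup) (h : CertCheck k N live (truth x N j) S a b W V l) :
    Certificate x N live.toFinset S.toFinset k (dist (x a) (x b)) W.toFinset V.toFinset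
      fun v => l.getD v 0 := by
  obtain ⟨⟨ha, hb, hab⟩, ⟨hSk, hSL⟩, ⟨hWn, hWk, hW⟩, hV, hc⟩ := h
  have hlt := fun v hv => hN v (hV v hv).1
  refine ⟨⟨a, ha, b, hb, rfl⟩, by simpa using hab.lt ha hb ha hb, fun i hi => ?_, ?_,
    ⟨fun w hw => ?_, fun v hv w hw hvw => ?_, fun w hw => ?_⟩, ?_,
    ⟨fun v hv => ?_, fun v hv => ?_, fun v hv w hw hvw => ?_, fun v hv => ?_, fun v hv => ?_⟩,
    fun p hp => ?_⟩
  · simp only [List.mem_toFinset] at hi ⊢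
    exact hSL i hi
  · rw [List.toFinset_card_of_nodup hS, hSk]
  · simp only [List.mem_toFinset] at hw ⊢
    exact (hW w hw).1
  · rw [List.mem_toFinset] at hv hw
    simpa using (((hW w hw).2.1 v hv).resolve_left hvw).le
  · rw [List.mem_toFinset] at hw
    obtain ⟨f, hf, h⟩ := (hW w hw).2.2
    exact ⟨f, List.mem_toFinset.2 hf, by simpa using h.le⟩
  · rw [List.toFinset_card_of_nodup hWn, hWk]
  · simp only [List.mem_toFinset] at hv ⊢
    exact (hV v hv).1
  · rw [List.mem_toFinset] at hv
    exact (hV v hv).2.1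
  · rw [List.mem_toFinset] at hv hw
    simpa using (((hV v hv).2.2.1 w hw).resolve_left hvw).lt (hlt v hv) (hlt w hw) ha hb
  · rw [List.mem_toFinset] at hv
    simpa using (hV v hv).2.2.2.1.le
  · rw [List.mem_toFinset] at hv
    refine (hV v hv).2.2.2.2.imp List.mem_toFinset.2 fun ⟨e, f, hf, h⟩ =>
      ⟨e, f, List.mem_toFinset.2 hf, by simpa using h.le⟩
  · rw [List.mem_toFinset] at hp
    obtain ⟨v, hv, h⟩ := hc p hp
    exact ⟨v, List.mem_toFinset.2 hv, by simpa using h.le⟩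

theorem Certificate.exists_certCheck {live : List ℕ} {S W V : Finset ℕ} {s : ℝ} {o : ℕ → ℕ}
    (hN : ∀ i ∈ live, i < N) (hC : Certificate x N live.toFinset S k s W V o) :
    ∃ J a b l, ∀ j ≥ J, CertCheck k N live (truth x N j) S.toList a b W.toList V.toList l := by
  obtain ⟨J, hJ⟩ := exists_knows x N
  obtain ⟨a, ha, b, hb, rfl⟩ := hC.scale
  have hS : ∀ i ∈ S, i ∈ live := fun i hi => List.mem_toFinset.1 (hC.subset hi)
  have hW : ∀ i ∈ W, i ∈ live := fun i hi => List.mem_toFinset.1 (hC.anchors.subset hi)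
  have hV : ∀ i ∈ V, i ∈ live := fun i hi => List.mem_toFinset.1 (hC.reps.subset hi)
  -- The origins are tabulated for all names below `N`, so the default of `getD` is never used.
  have ho : ∀ v ∈ V, ((List.range N).map o).getD v 0 = o v := fun v hv => by
    simp [List.getD, List.getElem?_range (hN v (hV v hv))]
  refine ⟨J, a, b, (List.range N).map o, fun j hj => ?_⟩
  specialize hJ j hj
  refine ⟨⟨ha, hb, (hJ a ha b hb a ha b hb 1 (by simp) 0 (by simp)).2 (by simpa using hC.pos)⟩,
    ⟨by simpa using hC.card, fun i hi => hS i (Finset.mem_toList.1 hi)⟩,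
    ⟨W.nodup_toList, by simpa using hC.card_anchors, fun w hw => ?_⟩, fun v hv => ?_, fun p hp => ?_⟩
  · rw [Finset.mem_toList] at hw
    have hwN := hN w (hW w hw)
    refine ⟨hW w hw, fun v hv => ?_, ?_⟩
    · rw [Finset.mem_toList] at hv
      refine or_iff_not_imp_left.2 fun hvw =>
        (hJ a ha b hb v (hN v (hW v hv)) w hwN 1 (by simp) 1 (by simp)).1 ?_
      simpa using hC.anchors.sep v hv w hw hvw
    · obtain ⟨f, hf, h⟩ := hC.anchors.near w hw
      exact ⟨f, Finset.mem_toList.2 hf,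
        (hJ w hwN f (hN f (hS f hf)) a ha b hb 4 (by simp) 1 (by simp)).1 (by simpa using h)⟩
  · rw [Finset.mem_toList] at hv
    have hvN := hN v (hV v hv)
    rw [ho v hv]
    refine ⟨hV v hv, hC.reps.lt v hv, fun w hw => ?_,
      (hJ v hvN _ (hC.reps.lt v hv) a ha b hb 1 (by simp) 15 (by simp)).1
        (by simpa using hC.reps.rep v hv),
      (hC.reps.real v hv).imp Finset.mem_toList.2 fun ⟨e, f, hf, h⟩ =>
        ⟨e, f, Finset.mem_toList.2 hf,
          (hJ v hvN f (hN f (hS f hf)) a ha b hb 4 (by simp) 5 (by simp)).1 (by simpa using h)⟩⟩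
    rw [Finset.mem_toList] at hw
    refine or_iff_not_imp_left.2 fun hvw =>
      (hJ v hvN w (hN w (hV w hw)) a ha b hb 1 (by simp) 5 (by simp)).2 ?_
    simpa using hC.reps.sep v hv w hw hvw
  · obtain ⟨v, hv, h⟩ := hC.covers p (List.mem_toFinset.2 hp)
    refine ⟨v, Finset.mem_toList.2 hv, ?_⟩
    rw [ho v hv]
    exact (hJ p (hN p hp) _ (hC.reps.lt v hv) a ha b hb 1 (by simp) 10 (by simp)).1
      (by simpa using h)

theorem card_sdiff_le_one_iff {S T : List ℕ} : (T.toFinset \ S.toFinset).card ≤ 1 ↔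
    ∀ i ∈ T, ∀ j ∈ T, i ∈ S ∨ j ∈ S ∨ i = j := by
  simp only [Finset.card_le_one, Finset.mem_sdiff, List.mem_toFinset]
  refine ⟨fun h i hi j hj => ?_, fun h i hi j hj => ?_⟩
  · have := h i
    tauto
  · have := h i hi.1 j hj.1
    tauto

theorem Check.sound {live S : List ℕ} {ph j : ℕ} {c : Candidate} (hN : ∀ i ∈ live, i < N)
    (hlive : live.Nodup) (h : Check k (N, live, S, truth x N j, ph) c) :
    c.1.Nodup ∧ Admissible x N live.toFinset c.1.toFinset k ∧
      (ph = 0 ∨ OneSwap S.toFinset c.1.toFinset) := by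
  refine ⟨h.nodup, ⟨fun hL => ?_, fun hL => ?_⟩, h.swap.imp_right fun h =>
    ⟨card_sdiff_le_one_iff.2 h.1, card_sdiff_le_one_iff.2 h.2⟩⟩
  · rw [List.toFinset_card_of_nodup hlive] at hL
    rcases h.good with h | h
    · ext i
      simp only [List.mem_toFinset]
      exact ⟨h.2.1 i, h.2.2 i⟩
    · exact absurd hL (not_le.2 h.1)
  · rw [List.toFinset_card_of_nodup hlive] at hL
    rcases h.good with h' | h'
    · exact absurd hL (not_lt.2 h'.1)
    · exact ⟨_, _, _, _, h'.2.certificate hN h.nodup⟩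

theorem Admissible.exists_check {live S : List ℕ} {S' : Finset ℕ} {ph : ℕ}
    (hN : ∀ i ∈ live, i < N) (hlive : live.Nodup) (hA : Admissible x N live.toFinset S' k)
    (hS : ph = 0 ∨ OneSwap S.toFinset S') :
    ∃ j, Check k (N, live, S, truth x N (j + 1), ph) (candidate (j + 1)) := by
  obtain ⟨J, c, hc⟩ : ∃ J, ∃ c : Candidate, ∀ j ≥ J, Check k (N, live, S, truth x N j, ph) c := by
    have hswap : ph = 0 ∨ (∀ i ∈ S'.toList, ∀ j ∈ S'.toList, i ∈ S ∨ j ∈ S ∨ i = j) ∧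
        ∀ i ∈ S, ∀ j ∈ S, i ∈ S'.toList ∨ j ∈ S'.toList ∨ i = j := by
      refine hS.imp_right fun h => ⟨card_sdiff_le_one_iff.1 ?_, card_sdiff_le_one_iff.1 ?_⟩
      · simpa using h.1
      · simpa using h.2
    rcases le_or_gt live.length k with hL | hL
    · have := hA.eq (by rwa [List.toFinset_card_of_nodup hlive])
      subst this
      exact ⟨0, (live.toFinset.toList, (0, 0), [], [], []), fun j _ =>
        ⟨Finset.nodup_toList _, hswap, .inl ⟨hL, by simp, by simp⟩⟩⟩
    · obtain ⟨s, W, V, o, hC⟩ := hA.certified (by rwa [List.toFinset_card_of_nodup hlive])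
      obtain ⟨J, a, b, l, h⟩ := hC.exists_certCheck hN
      exact ⟨J, (S'.toList, (a, b), W.toList, V.toList, l), fun j hj =>
        ⟨Finset.nodup_toList _, hswap, .inr ⟨hL, h j hj⟩⟩⟩
  -- Padding the code of `c` with `J + 1` yields an index with enough answers. It is also positive,
  -- as needed because a candidate is tested only after an answer.
  have hle := Nat.right_le_pair (Encodable.encode c) (J + 1)
  refine ⟨Nat.pair (Encodable.encode c) (J + 1) - 1, ?_⟩
  rw [Nat.sub_add_cancel (by omega)]
  have : candidate (Nat.pair (Encodable.encode c) (J + 1)) = c := by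
    rw [candidate, Nat.unpair_pair, Encodable.encodek, Option.getD_some]
  rw [this]
  exact hc _ (by omega)

theorem memory_cons (k n₀ : ℕ) (m : Message) (h : List Message) :
    memory k n₀ (m :: h) = step k (memory k n₀ h) m := by
  simp [memory]

theorem test_of_check {live S : List ℕ} {ph j : ℕ}
    (h : Check k (N, live, S, truth x N j, ph) (candidate j)) :
    test k (N, live, S, truth x N j, ph) = (N, live, (candidate j).1, truth x N j, 2) := by
  rw [test, if_pos (by simpa only [length_truth] using h)]
  simp only [length_truth]

theorem test_of_not_check {live S : List ℕ} {ph j : ℕ}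
    (h : ¬ Check k (N, live, S, truth x N j, ph) (candidate j)) :
    test k (N, live, S, truth x N j, ph) = (N, live, S, truth x N j, ph) := by
  rw [test, if_neg (by simpa only [length_truth] using h)]

/-- Induction on the number of questions still to be asked. The search may stop at an earlier
candidate, so the conclusion only provides some candidate that passed the check. -/
theorem exists_responds_of_check {live S : List ℕ} {ph : ℕ} (hph : ph ≠ 2) {j d : ℕ}
    {h : List Message} (hM : memory k n₀ h = (N, live, S, truth x N j, ph))
    (hc : Check k (N, live, S, truth x N (j + d + 1), ph) (candidate (j + d + 1))) :
    ∃ h' S', Responds x N k n₀ algorithm h h' S' ∧ ∃ i c, c.1 = S' ∧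
      memory k n₀ h' = (N, live, S', truth x N i, 2) ∧
      Check k (N, live, S, truth x N i, ph) c := by
  induction d generalizing j h with
  | zero =>
    have hM' : memory k n₀ (.answer ((question j).eval x N) :: h) =
        test k (N, live, S, truth x N (j + 1), ph) := by
      rw [truth_succ, memory_cons, hM]
      rfl
    rw [test_of_check hc] at hM'
    refine ⟨_, _, .ask (q := question j) ?_ (.output ?_), j + 1, _, rfl, hM', hc⟩
    · simp [algorithm, hM, act, hph, length_truth]
    · simp [algorithm, hM', act]
  | succ d ih =>
    have hask : algorithm.next k n₀ h = .ask (question j) := by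
      simp [algorithm, hM, act, hph, length_truth]
    have hM' : memory k n₀ (.answer ((question j).eval x N) :: h) =
        test k (N, live, S, truth x N (j + 1), ph) := by
      rw [truth_succ, memory_cons, hM]
      rfl
    by_cases hj : Check k (N, live, S, truth x N (j + 1), ph) (candidate (j + 1))
    · rw [test_of_check hj] at hM'
      refine ⟨_, _, .ask hask (.output ?_), j + 1, _, rfl, hM', hj⟩
      simp [algorithm, hM', act]
    · rw [test_of_not_check hj] at hM'
      obtain ⟨h', S', hr, hh⟩ := ih hM' (by rwa [show j + 1 + d + 1 = j + (d + 1) + 1 by omega])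
      exact ⟨h', S', .ask hask hr, hh⟩

end Run

/-! ### The run on a legal input -/

section Run

variable {X : Type*} [MetricSpace X] {x : ℕ → X} {k n₀ T : ℕ} {u : ℕ → Update}

theorem mem_live_lt (n₀ : ℕ) (u : ℕ → Update) (t : ℕ) :
    ∀ i ∈ (population n₀ u t).live, i < (population n₀ u t).arrived := by
  induction t with
  | zero => simp [population, Population.initial]
  | succ t ih =>
    intro i hi
    simp only [population] at hi ⊢
    cases hu : u t with
    | insert =>
      rw [hu] at hi
      rcases Finset.mem_insert.1 hi with rfl | hi
      · exact Nat.lt_succ_self _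
      · exact (ih i hi).trans (Nat.lt_succ_self _)
    | delete d =>
      rw [hu] at hi
      exact ih i (Finset.mem_of_mem_erase hi)

theorem LegalInput.injOn {Y : Type*} {x : ℕ → Y} (h : LegalInput x n₀ u T) {t : ℕ} (ht : t ≤ T) :
    ∀ i ∈ (population n₀ u t).live, ∀ j ∈ (population n₀ u t).live, x i = x j → i = j := by
  induction t with
  | zero =>
    intro i hi j hj
    simp only [population, Population.initial, Finset.mem_range] at hi hj
    exact h.1 i hi j hj
  | succ t ih =>
    have hl := h.2 t ht
    specialize ih (by omega)
    intro i hi j hj hij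
    simp only [population] at hi hj
    cases hu : u t with
    | insert =>
      rw [hu] at hi hj hl
      have hnew : ∀ i ∈ (population n₀ u t).live, x i ≠ x (population n₀ u t).arrived :=
        fun i hi e => hl (mem_pointsOf.2 ⟨i, hi, e⟩)
      rcases Finset.mem_insert.1 hi with rfl | hi' <;> rcases Finset.mem_insert.1 hj with rfl | hj'
      · rfl
      · exact absurd hij.symm (hnew j hj')
      · exact absurd hij (hnew i hi')
      · exact ih i hi' j hj' hij
    | delete d =>
      rw [hu] at hi hj
      exact ih i (Finset.mem_of_mem_erase hi) j (Finset.mem_of_mem_erase hj) hij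

/-- After an update has been processed, the memory agrees with the population, and the announced
centers satisfy the invariant. -/
structure Ready (x : ℕ → X) (k n₀ : ℕ) (w : Population) (h : List Message) (S : List ℕ) : Prop where
  memory : ∃ live ans, memory k n₀ h = (w.arrived, live, S, ans, 2) ∧ live.Nodup ∧
    live.toFinset = w.live
  nodup : S.Nodup
  admissible : Admissible x w.arrived w.live S.toFinset k

/-- The admissible set `S'` forces the search to end. The announced set may be a different one, and
its properties come from `Check.sound`. -/
theorem exists_ready {w : Population} (hw : ∀ i ∈ w.live, i < w.arrived) {h : List Message}
    {live S : List ℕ} {ph : ℕ} (hph : ph ≠ 2) (hM : memory k n₀ h = (w.arrived, live, S, [], ph))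
    (hlive : live.Nodup) (hlw : live.toFinset = w.live)
    (hA : ∃ S', (ph = 0 ∨ OneSwap S.toFinset S') ∧ Admissible x w.arrived w.live S' k) :
    ∃ h' S', Responds x w.arrived k n₀ algorithm h h' S' ∧ Ready x k n₀ w h' S' ∧
      (ph = 0 ∨ OneSwap S.toFinset S'.toFinset) := by
  obtain ⟨S', hsw, hA⟩ := hA
  have hN : ∀ i ∈ live, i < w.arrived := fun i hi => hw i (hlw ▸ List.mem_toFinset.2 hi)
  rw [← hlw] at hA
  obtain ⟨d, hd⟩ := hA.exists_check hN hlive hsw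
  obtain ⟨h', S', hr, i, c, rfl, hM', hc⟩ := exists_responds_of_check (n₀ := n₀) (h := h) (x := x)
    hph (j := 0) (d := d) hM (by rwa [Nat.zero_add])
  obtain ⟨h1, h2, h3⟩ := hc.sound hN hlive
  exact ⟨h', _, hr, ⟨⟨live, _, hM', hlive, hlw⟩, h1, hlw ▸ h2⟩, h3⟩

theorem LegalInput.exists_ready_zero (hu : LegalInput x n₀ u T) (hk : 1 ≤ k) :
    ∃ h S, Responds x n₀ k n₀ algorithm [] h S ∧ Ready x k n₀ (population n₀ u 0) h S := by
  obtain ⟨S, hS⟩ := exists_admissible_range hk n₀ hu.1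
  obtain ⟨h, S', h1, h2, -⟩ := exists_ready (x := x) (k := k) (n₀ := n₀) (h := []) (S := [])
    (mem_live_lt n₀ u 0) (ph := 0) (by simp) (live := List.range n₀) rfl List.nodup_range
    (by ext; simp [population, Population.initial]) ⟨S, .inl rfl, hS⟩
  exact ⟨h, S', h1, h2⟩

theorem LegalInput.exists_ready_succ (hu : LegalInput x n₀ u T) (hk : 1 ≤ k) {t : ℕ} (ht : t < T)
    {h : List Message} {S : List ℕ} (hr : Ready x k n₀ (population n₀ u t) h S) :
    ∃ h' S', Responds x (population n₀ u (t + 1)).arrived k n₀ algorithm (.update (u t) :: h) h' S' ∧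
      Ready x k n₀ (population n₀ u (t + 1)) h' S' ∧ OneSwap S.toFinset S'.toFinset := by
  obtain ⟨live, ans, hM, hlive, hlw⟩ := hr.memory
  have hM' : memory k n₀ (.update (u t) :: h) =
      updateStep ((population n₀ u t).arrived, live, S, ans, 2) (u t) := by
    rw [memory_cons, hM]
    rfl
  have hlt := mem_live_lt n₀ u t
  have hinj := hu.injOn ht
  have hlt' := mem_live_lt n₀ u (t + 1)
  suffices H : ∃ live', memory k n₀ (.update (u t) :: h) =
      ((population n₀ u (t + 1)).arrived, live', S, [], 1) ∧ live'.Nodup ∧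
      live'.toFinset = (population n₀ u (t + 1)).live ∧
      ∃ S', OneSwap S.toFinset S' ∧ Admissible x (population n₀ u (t + 1)).arrived
        (population n₀ u (t + 1)).live S' k by
    obtain ⟨live', h1, h2, h3, S', h4, h5⟩ := H
    obtain ⟨h', S', h6, h7, h8⟩ := exists_ready (x := x) hlt' (by simp) h1 h2 h3 ⟨S', .inr h4, h5⟩
    exact ⟨h', S', h6, h7, h8.resolve_left (by simp)⟩
  have hl := hu.2 t ht
  simp only [population] at hinj ⊢
  cases e : u t with
  | insert =>
    rw [e] at hM' hinj
    refine ⟨_, hM', ?_, ?_, ?_⟩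
    · exact List.nodup_cons.2 ⟨fun h => (hlt _ (hlw ▸ List.mem_toFinset.2 h)).false, hlive⟩
    · simp [Population.apply, hlw]
    · exact hr.admissible.step_insert hk hlt hinj
  | delete d =>
    rw [e] at hM' hl
    refine ⟨_, hM', ?_, ?_, ?_⟩
    · exact hlive.filter _
    · ext i
      simp [Population.apply, ← hlw, and_comm]
    · exact hr.admissible.step_delete hk hlt (hu.injOn ht.le) hl

theorem LegalInput.exists_run (hu : LegalInput x n₀ u T) (hk : 1 ≤ k) :
    ∃ h S, IsRun algorithm k x n₀ u T h S ∧
      (∀ t ≤ T, Ready x k n₀ (population n₀ u t) (h t) (S t)) ∧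
      ∀ t < T, OneSwap (S t).toFinset (S (t + 1)).toFinset := by
  obtain ⟨h₀, S₀, hr₀, hS₀⟩ := hu.exists_ready_zero hk
  have key : ∀ t (p : List Message × List ℕ), ∃ p' : List Message × List ℕ, t < T →
      Ready x k n₀ (population n₀ u t) p.1 p.2 →
      Responds x (population n₀ u (t + 1)).arrived k n₀ algorithm (.update (u t) :: p.1) p'.1 p'.2 ∧
      Ready x k n₀ (population n₀ u (t + 1)) p'.1 p'.2 ∧
      OneSwap p.2.toFinset p'.2.toFinset := by
    intro t p
    by_cases hp : t < T ∧ Ready x k n₀ (population n₀ u t) p.1 p.2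
    · obtain ⟨h', S', hh⟩ := hu.exists_ready_succ hk hp.1 hp.2
      exact ⟨(h', S'), fun _ _ => hh⟩
    -- A junk value that makes `next` total; it never occurs in the first `T` steps.
    · exact ⟨p, fun h1 h2 => absurd ⟨h1, h2⟩ hp⟩
  choose next hnext using key
  let run : ℕ → List Message × List ℕ := fun t => Nat.rec (h₀, S₀) next t
  have hready : ∀ t ≤ T, Ready x k n₀ (population n₀ u t) (run t).1 (run t).2 := by
    intro t ht
    induction t with
    | zero => exact hS₀
    | succ t ih => exact (hnext t (run t) ht (ih (by omega))).2.1
  exact ⟨fun t => (run t).1, fun t => (run t).2,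
    ⟨hr₀, fun t ht => (hnext t (run t) ht (hready t ht.le)).1⟩, hready,
    fun t ht => (hnext t (run t) ht (hready t ht.le)).2.2⟩

theorem ncard_centers_sdiff_le {Y : Type*} {x : ℕ → Y} {S S' : List ℕ} (h : (S'.toFinset \ S.toFinset).card ≤ 1) :
    ((centers x S' : Set Y) \ centers x S).ncard ≤ 1 := by
  classical
  refine (Set.ncard_le_ncard (t := ((S'.toFinset \ S.toFinset).image x : Finset Y))
    ?_ (Finset.finite_toSet _)).trans ?_
  · rintro p ⟨hp, hp'⟩
    obtain ⟨i, hi, rfl⟩ := mem_pointsOf.1 hp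
    exact Finset.mem_coe.2 (Finset.mem_image.2 ⟨i, Finset.mem_sdiff.2
      ⟨hi, fun hi' => hp' (mem_pointsOf.2 ⟨i, hi', rfl⟩)⟩, rfl⟩)
  · rw [Set.ncard_coe_finset]
    exact Finset.card_image_le.trans h

theorem card_pointsOf {Y : Type*} {x : ℕ → Y} {L : Finset ℕ} (hinj : ∀ i ∈ L, ∀ j ∈ L, x i = x j → i = j) :
    (pointsOf x L).card = L.card := by
  classical
  rw [pointsOf]
  convert Finset.card_image_of_injOn (s := L) (f := x) fun i hi j hj => hinj i hi j hj

end Run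

end KCenter

theorem mainTheorem1 :
    ∃ A : KCenter.DynamicAlgorithm,
      ∀ (X : Type*) [MetricSpace X] (k : ℕ), 1 ≤ k →
      ∀ (x : ℕ → X) (n₀ : ℕ) (u : ℕ → KCenter.Update) (T : ℕ), KCenter.LegalInput x n₀ u T →
        ∃ (h : ℕ → List KCenter.Message) (S : ℕ → List ℕ),
          KCenter.IsRun A k x n₀ u T h S ∧
          (∀ t ≤ T,
            let w := KCenter.population n₀ u t
            let P := w.points x
            let C := KCenter.centers x (S t)
            (S t).Nodup ∧ (∀ i ∈ S t, i ∈ w.live) ∧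
            (k ≤ P.card → C.card = k) ∧ (P.card < k → C = P) ∧
            KCenter.IsDominatingSet P C (50 * KCenter.optRadius P k)) ∧
          (∀ t < T,
            ((KCenter.centers x (S (t + 1)) : Set X) \ KCenter.centers x (S t)).ncard ≤ 1 ∧
            ((KCenter.centers x (S t) : Set X) \ KCenter.centers x (S (t + 1))).ncard ≤ 1) := by
  refine ⟨KCenter.algorithm, fun X _ k hk x n₀ u T hu => ?_⟩
  obtain ⟨h, S, hrun, hready, hswap⟩ := hu.exists_run hk
  refine ⟨h, S, hrun, fun t ht => ?_, fun t ht =>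
    ⟨KCenter.ncard_centers_sdiff_le (hswap t ht).1, KCenter.ncard_centers_sdiff_le (hswap t ht).2⟩⟩
  intro w P C
  have hr := hready t ht
  have hA := hr.admissible
  have hinj := hu.injOn ht
  have hP : P.card = w.live.card := KCenter.card_pointsOf hinj
  have hC : C.card = (S t).toFinset.card := KCenter.card_pointsOf fun i hi j hj =>
    hinj i (hA.subset hi) j (hA.subset hj)
  refine ⟨hr.nodup, fun i hi => hA.subset (List.mem_toFinset.2 hi), fun hkP => ?_, fun hkP => ?_,
    hA.isDominatingSet⟩
  · rw [hP] at hkP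
    rw [hC]
    rcases hkP.eq_or_lt with h' | h'
    · rw [hA.eq h'.ge, ← h']
    · obtain ⟨s, W, V, o, hcert⟩ := hA.certified h'
      exact hcert.card
  · rw [hP] at hkP
    change KCenter.pointsOf x _ = KCenter.pointsOf x _
    rw [hA.eq hkP.le]
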